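/- Let $c_1$, $c_2$ and $c_3$ be positive integers that are pairwise coprime, and let $C$ be a positive common multiple of $c_1$, $c_2$ and $c_3$. Then for any odd prime $p$ dividing none of $c_1$, $c_2$, $c_3$, and any positive integer $r$, $$\sum_{\substack{i,j,k\ge 1\\ \gcd(ijk,p)=1\\ c_1 i+c_2 j+c_3 k=Cp^r}}\frac{1}{ijk}\equiv -2p^{r-1}B_{p-3}\cdot \frac{C}{3}\left(\frac{1}{c_1^2}+\frac{1}{c_2^2}+\frac{1}{c_3^2}\right) \pmod{p^r}.$$ Here $B_n$ is the $n$-th Bernoulli number, defined by $\frac{z}{e^z-1}=\sum_{n\ge 0}\frac{B_n z^n}{n!}$. The congruence is between rational numbers: both sides are $p$-integral (the prime $p$ does not divide their denominators in lowest terms), and their difference is $p^r$ times a $p$-integral rational number. -/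

import Mathlib

namespace HarmonicCongruence

/-- A rational number is `p`-integral (a `p`-adic integer) when `p` does not divide its
denominator in lowest terms. -/
def PIntegral (p : ℕ) (x : ℚ) : Prop := ¬ p ∣ x.den

/-- Congruence of rational numbers modulo `p ^ r`: both sides are `p`-integral, and their
difference is `p ^ r` times a `p`-integral rational number. -/
def RatModEq (p r : ℕ) (x y : ℚ) : Prop :=
  PIntegral p x ∧ PIntegral p y ∧ ∃ z : ℚ, PIntegral p z ∧ x - y = (p : ℚ) ^ r * z

/-- The triples `(i, j, k)` of positive integers with `gcd (i j k, p) = 1` and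
`c₁ i + c₂ j + c₃ k = N`. For positive `c₁`, `c₂`, `c₃` the upper bound `N` on the
coordinates is automatic, see `mem_solutions`. -/
def solutions (c₁ c₂ c₃ p N : ℕ) : Finset (ℕ × ℕ × ℕ) :=
  (Finset.Icc 1 N ×ˢ Finset.Icc 1 N ×ˢ Finset.Icc 1 N).filter
    (fun t => Nat.Coprime (t.1 * t.2.1 * t.2.2) p ∧
      c₁ * t.1 + c₂ * t.2.1 + c₃ * t.2.2 = N)

theorem mem_solutions {c₁ c₂ c₃ : ℕ} (h₁ : 0 < c₁) (h₂ : 0 < c₂) (h₃ : 0 < c₃)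
    (p N i j k : ℕ) :
    (i, j, k) ∈ solutions c₁ c₂ c₃ p N ↔
      1 ≤ i ∧ 1 ≤ j ∧ 1 ≤ k ∧ Nat.gcd (i * j * k) p = 1 ∧ c₁ * i + c₂ * j + c₃ * k = N := by
  simp only [solutions, Finset.mem_filter, Finset.mem_product, Finset.mem_Icc,
    Nat.coprime_iff_gcd_eq_one]
  constructor
  · rintro ⟨⟨⟨hi, -⟩, ⟨hj, -⟩, hk, -⟩, hg, hN⟩
    exact ⟨hi, hj, hk, hg, hN⟩
  · rintro ⟨hi, hj, hk, hg, hN⟩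
    have e₁ := Nat.le_mul_of_pos_left i h₁
    have e₂ := Nat.le_mul_of_pos_left j h₂
    have e₃ := Nat.le_mul_of_pos_left k h₃
    exact ⟨⟨⟨hi, by omega⟩, ⟨hj, by omega⟩, hk, by omega⟩, hg, hN⟩

end HarmonicCongruence

/-! Put q = p^r and C = t c₁c₂c₃, and sort the solutions by their residues (a, b, c) mod q, with
representatives in [0, q). A class with q m = c₁a + c₂b + c₃c contains as many solutions as c₁u +
c₂v + c₃w = t c₁c₂c₃ - m has in natural numbers. For the m that occur this number is A - t m, with A
independent of the class (`exists_count₃_eq`).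

Replacing a by a/c₁, and so on, makes the condition a + b + c = 0 and splits m into three carries of
multiplication by cᵢ and one carry of the addition (`sum_solutions_eq_carries`). The constant A
contributes 0 because 1/(abc) is odd. A multiplication carry involves one variable only, and summing
1/(abc) over the other gives -2p^(r-1)/a³ (`ringInverse_mul_sum`). What is left is a Voronoi sum,
which yields p^(r-1) (1 - cᵢ⁻²) B_{p-3}/3.

The addition carry contributes a sum E independent of the cᵢ. Scaling by 2 relates E to the Voronoi
sum for c = 2 (`six_mul_sum_addCarry`), whence E = 2p^(r-1) B_{p-3} for p ≥ 5. For p = 3 neither 6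
nor the 3 in C/3 is invertible: E is computed directly (`sum_addCarry_three`), and (1 - cᵢ⁻²)/3 is
replaced by an integral expression. -/

namespace HarmonicCongruence

/-! ### Counting representations by pairwise coprime coefficients -/

/-- The sum of `f x, f (x - c), f (x - 2 c), …`, for `f` vanishing at negative integers. -/
def backSum (c : ℕ) (f : ℤ → ℤ) (x : ℤ) : ℤ := ∑ j ∈ Finset.range (x.toNat + 1), f (x - c * j)

theorem backSum_of_neg {c : ℕ} {f : ℤ → ℤ} (hf : ∀ x < 0, f x = 0) {x : ℤ} (hx : x < 0) :
    backSum c f x = 0 := by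
  have : x.toNat = 0 := by omega
  simp [backSum, this, hf x hx]

theorem backSum_eq_sum_range {c : ℕ} (hc : 0 < c) {f : ℤ → ℤ} (hf : ∀ x < 0, f x = 0) {x : ℤ}
    {K : ℕ} (hK : x < K) : backSum c f x = ∑ j ∈ Finset.range K, f (x - c * j) := by
  have key : ∀ K L : ℕ, x < K → K ≤ L → ∑ j ∈ Finset.range K, f (x - c * j)
      = ∑ j ∈ Finset.range L, f (x - c * j) := by
    intro K L hK hKL
    apply Finset.sum_subset (Finset.range_mono hKL)
    intro j _ hj
    apply hf
    have hj : K ≤ j := by simpa using hj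
    have : (j : ℤ) ≤ c * j := by
      have := Nat.le_mul_of_pos_left j hc
      exact_mod_cast this
    omega
  rw [backSum, key _ (max K (x.toNat + 1)) (by omega) (le_max_right _ _),
    key K _ hK (le_max_left _ _)]

theorem backSum_add {c : ℕ} (hc : 0 < c) {f : ℤ → ℤ} (hf : ∀ x < 0, f x = 0) (x : ℤ) :
    backSum c f (x + c) = backSum c f x + f (x + c) := by
  rw [backSum_eq_sum_range hc hf (K := (x + c).toNat + 1 + 1) (by omega), Finset.sum_range_succ',
    backSum_eq_sum_range hc hf (x := x) (K := (x + c).toNat + 1) (by omega)]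
  congr 1
  · refine Finset.sum_congr rfl fun j _ => ?_
    congr 1
    push_cast
    ring
  · simp

theorem backSum_add_mul {c : ℕ} (hc : 0 < c) {f : ℤ → ℤ} (hf : ∀ x < 0, f x = 0) (x : ℤ) (n : ℕ) :
    backSum c f (x + c * n) = backSum c f x + ∑ j ∈ Finset.range n, f (x + c * (j + 1)) := by
  induction n with
  | zero => simp
  | succ n ih =>
    have e : x + (c : ℤ) * ((n + 1 : ℕ) : ℤ) = x + c * n + c := by push_cast; ring
    rw [e, backSum_add hc hf, ih, Finset.sum_range_succ, add_assoc]
    congr 3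
    ring

/-- A function that is periodic beyond `L` has the same sum over all complete residue systems
in arithmetic progression beyond `L`. -/
theorem exists_sum_residues_eq {M : ℕ} (hM : 0 < M) {L : ℤ} {g : ℤ → ℤ}
    (hg : ∀ x > L, g (x + M) = g x) :
    ∃ K : ℤ, ∀ c : ℕ, Nat.Coprime c M → ∀ x : ℤ, L < x + c →
      ∑ j ∈ Finset.range M, g (x + c * (j + 1)) = K := by
  have : NeZero M := ⟨hM.ne'⟩
  have hper : ∀ (n : ℕ) (x : ℤ), L < x → g (x + M * n) = g x := by
    intro n x hx
    induction n with
    | zero => simp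
    | succ n ih =>
      have e : x + (M : ℤ) * ((n + 1 : ℕ) : ℤ) = x + M * n + M := by push_cast; ring
      have : (0 : ℤ) ≤ M * n := by positivity
      rw [e, hg _ (by omega), ih]
  -- Beyond L, g factors through `ZMod M`; G evaluates it at the representative in [L + 1, L + M].
  let G : ZMod M → ℤ := fun z => g (L + 1 + (z - ((L + 1 : ℤ) : ZMod M)).val)
  have hG : ∀ x > L, g x = G (x : ZMod M) := by
    intro x hx
    obtain ⟨y, hy⟩ : ∃ y : ℕ, x = L + 1 + y := ⟨(x - (L + 1)).toNat, by omega⟩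
    have e : ((x : ZMod M) - ((L + 1 : ℤ) : ZMod M)) = (y : ZMod M) := by
      rw [hy]; push_cast; ring
    simp only [G]
    rw [e, ZMod.val_natCast, hy]
    conv_lhs => rw [← Nat.mod_add_div y M]
    rw [Nat.cast_add, Nat.cast_mul, ← add_assoc, hper _ _ (by omega)]
  refine ⟨∑ z, G z, fun c hc x hx => ?_⟩
  have h1 : ∀ j ∈ Finset.range M, g (x + c * (j + 1)) = G ((x : ZMod M) + c * ((j : ZMod M) + 1)) := by
    intro j _
    have : (c : ℤ) ≤ c * (j + 1) := by nlinarith [Int.natCast_nonneg c, Int.natCast_nonneg j]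
    rw [hG _ (by omega)]
    push_cast
    rfl
  rw [Finset.sum_congr rfl h1]
  let u := ZMod.unitOfCoprime c hc
  let e : ZMod M ≃ ZMod M :=
    (Equiv.addRight (1 : ZMod M)).trans ((Units.mulLeft u).trans (Equiv.addLeft (x : ZMod M)))
  rw [← Equiv.sum_comp e G]
  refine Finset.sum_bij' (fun j _ => (j : ZMod M)) (fun z _ => z.val) ?_ ?_ ?_ ?_ ?_
  · simp
  · intro z _; simpa using ZMod.val_lt z
  · intro j hj; exact ZMod.val_cast_of_lt (by simpa using hj)
  · intro z _; simp
  · intro j _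
    simp [e, u]

/-- The indicator function of `0`. -/
def deltaZero (x : ℤ) : ℤ := if x = 0 then 1 else 0

theorem deltaZero_of_neg : ∀ x < 0, deltaZero x = 0 := fun x hx => by
  simp [deltaZero, hx.ne]

/-- The number of `(i, j)` in `ℕ × ℕ` with `c₁ i + c₂ j = x`. -/
def count₂ (c₁ c₂ : ℕ) : ℤ → ℤ := backSum c₂ (backSum c₁ deltaZero)

/-- The number of `(i, j, k)` in `ℕ × ℕ × ℕ` with `c₁ i + c₂ j + c₃ k = x`. -/
def count₃ (c₁ c₂ c₃ : ℕ) : ℤ → ℤ := backSum c₃ (count₂ c₁ c₂)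

theorem backSum_deltaZero_of_neg (c : ℕ) : ∀ x < 0, backSum c deltaZero x = 0 :=
  fun _ => backSum_of_neg deltaZero_of_neg

theorem count₂_of_neg (c₁ c₂ : ℕ) : ∀ x < 0, count₂ c₁ c₂ x = 0 :=
  fun _ => backSum_of_neg (backSum_deltaZero_of_neg c₁)

theorem count₃_of_neg (c₁ c₂ c₃ : ℕ) : ∀ x < 0, count₃ c₁ c₂ c₃ x = 0 :=
  fun _ => backSum_of_neg (count₂_of_neg c₁ c₂)

/-- Passing from x to x + c₁c₂ adds c₁ terms in steps of c₂, one for each residue mod c₁, and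
exactly one is a multiple of c₁. Negative x are allowed because no multiple of c₁ lies strictly
between -c₁ and 0. -/
theorem count₂_add {c₁ c₂ : ℕ} (h₁ : 0 < c₁) (h₂ : 0 < c₂) (h₁₂ : Nat.Coprime c₁ c₂) {x : ℤ}
    (hx : -(c₁ + c₂ : ℤ) < x) : count₂ c₁ c₂ (x + (c₁ * c₂ : ℕ)) = count₂ c₁ c₂ x + 1 := by
  have hper : ∀ x > (-c₁ : ℤ), backSum c₁ deltaZero (x + c₁) = backSum c₁ deltaZero x := by
    intro x hx
    rw [backSum_add h₁ deltaZero_of_neg]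
    have : x + c₁ ≠ 0 := by omega
    simp [deltaZero, this]
  obtain ⟨K, hK⟩ := exists_sum_residues_eq h₁ hper
  -- Steps of 1 from -1 run through 0, …, c₁ - 1, where only 0 is a multiple of c₁.
  have hK1 : K = 1 := by
    rw [← hK 1 (Nat.coprime_one_left _) (-1) (by push_cast; omega)]
    have : ∀ j ∈ Finset.range c₁, backSum c₁ deltaZero (-1 + (1 : ℕ) * (j + 1))
        = if j = 0 then 1 else 0 := by
      intro j hj
      have hj : j < c₁ := by simpa using hj
      have e : (-1 + (1 : ℕ) * (j + 1) : ℤ) = (j - c₁) + c₁ := by push_cast; ring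
      rw [e, backSum_add h₁ deltaZero_of_neg, backSum_deltaZero_of_neg _ _ (by omega)]
      simp [deltaZero]
    rw [Finset.sum_congr rfl this, Finset.sum_ite_eq' _ _ _, if_pos (by simpa using h₁)]
  have e : x + ((c₁ * c₂ : ℕ) : ℤ) = x + c₂ * c₁ := by push_cast; ring
  rw [count₂, e, backSum_add_mul h₂ (backSum_deltaZero_of_neg c₁), hK c₂ h₁₂.symm x (by omega), hK1]

/-- By `count₂_add`, `count₂` minus the linear function y/(c₁c₂) is periodic with period c₁c₂; it is
multiplied by c₁c₂ to stay in ℤ. Its sum over a complete residue system does not depend on the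
starting point, so the increment is x plus a constant. -/
theorem exists_count₃_add {c₁ c₂ c₃ : ℕ} (h₁ : 0 < c₁) (h₂ : 0 < c₂) (h₃ : 0 < c₃)
    (h₁₂ : Nat.Coprime c₁ c₂) (h₁₃ : Nat.Coprime c₁ c₃) (h₂₃ : Nat.Coprime c₂ c₃) :
    ∃ κ : ℤ, ∀ x : ℤ, -(c₁ + c₂ + c₃ : ℤ) < x →
      count₃ c₁ c₂ c₃ (x + (c₁ * c₂ * c₃ : ℕ)) = count₃ c₁ c₂ c₃ x + x + κ := by
  have hM : 0 < c₁ * c₂ := Nat.mul_pos h₁ h₂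
  have hper : ∀ x > (-(c₁ + c₂) : ℤ), (fun y => (c₁ * c₂ : ℕ) * count₂ c₁ c₂ y - y) (x + (c₁ * c₂ : ℕ))
      = (fun y => (c₁ * c₂ : ℕ) * count₂ c₁ c₂ y - y) x := by
    intro x hx
    simp only
    rw [count₂_add h₁ h₂ h₁₂ (by omega)]
    ring
  obtain ⟨K, hK⟩ := exists_sum_residues_eq
    (g := fun y => (c₁ * c₂ : ℕ) * count₂ c₁ c₂ y - y) hM hper
  set W : ℤ → ℤ := fun x => ∑ j ∈ Finset.range (c₁ * c₂), count₂ c₁ c₂ (x + c₃ * (j + 1)) with hW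
  have hWK : ∀ x : ℤ, -(c₁ + c₂ + c₃ : ℤ) < x → ((c₁ * c₂ : ℕ) : ℤ) * (W x - x)
      = K + ∑ j ∈ Finset.range (c₁ * c₂), (c₃ : ℤ) * (j + 1) := by
    intro x hx
    rw [← hK c₃ (Nat.Coprime.mul_right h₁₃.symm h₂₃.symm) x (by omega), ← Finset.sum_add_distrib,
      mul_sub, hW, Finset.mul_sum, sub_eq_iff_eq_add]
    have : ((c₁ * c₂ : ℕ) : ℤ) * x = ∑ j ∈ Finset.range (c₁ * c₂), x := by simp
    rw [this, ← Finset.sum_add_distrib]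
    refine Finset.sum_congr rfl fun j _ => ?_
    ring
  refine ⟨W 0, fun x hx => ?_⟩
  have e : x + ((c₁ * c₂ * c₃ : ℕ) : ℤ) = x + c₃ * (c₁ * c₂ : ℕ) := by push_cast; ring
  have h0 := (hWK x hx).trans (hWK 0 (by omega)).symm
  have h := mul_left_cancel₀ (by exact_mod_cast hM.ne') h0
  rw [count₃, e, backSum_add_mul h₃ (count₂_of_neg c₁ c₂)]
  change _ + W x = _
  linarith

/-- Iterating `exists_count₃_add` from t = 0, where every argument -m is negative and the count is
0, adds -m to the count at each step. The value of A is never needed, since `sum_invProd` removes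
it. -/
theorem exists_count₃_eq {c₁ c₂ c₃ : ℕ} (h₁ : 0 < c₁) (h₂ : 0 < c₂) (h₃ : 0 < c₃)
    (h₁₂ : Nat.Coprime c₁ c₂) (h₁₃ : Nat.Coprime c₁ c₃) (h₂₃ : Nat.Coprime c₂ c₃) (t : ℕ) :
    ∃ A : ℤ, ∀ m : ℕ, 0 < m → m < c₁ + c₂ + c₃ →
      count₃ c₁ c₂ c₃ ((t * (c₁ * c₂ * c₃) : ℕ) - m) = A - t * m := by
  obtain ⟨κ, hκ⟩ := exists_count₃_add h₁ h₂ h₃ h₁₂ h₁₃ h₂₃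
  induction t with
  | zero =>
    refine ⟨0, fun m hm _ => ?_⟩
    rw [count₃_of_neg _ _ _ _ (by push_cast; omega)]
    simp
  | succ t ih =>
    obtain ⟨A, hA⟩ := ih
    refine ⟨A + (t * (c₁ * c₂ * c₃) : ℕ) + κ, fun m hm hm' => ?_⟩
    have e : (((t + 1) * (c₁ * c₂ * c₃) : ℕ) : ℤ) - m
        = ((t * (c₁ * c₂ * c₃) : ℕ) - m) + (c₁ * c₂ * c₃ : ℕ) := by push_cast; ring
    have : (0 : ℤ) ≤ (t * (c₁ * c₂ * c₃) : ℕ) := by positivity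
    rw [e, hκ _ (by omega), hA m hm hm']
    push_cast
    ring

theorem count₃_eq_sum {c₁ c₂ c₃ : ℕ} (h₁ : 0 < c₁) (h₂ : 0 < c₂) (h₃ : 0 < c₃) {x : ℤ} {K : ℕ}
    (hK : x < K) : count₃ c₁ c₂ c₃ x = ∑ k ∈ Finset.range K, ∑ j ∈ Finset.range K,
      ∑ i ∈ Finset.range K, if (c₁ * i + c₂ * j + c₃ * k : ℤ) = x then 1 else 0 := by
  rw [count₃, backSum_eq_sum_range h₃ (count₂_of_neg c₁ c₂) hK]
  refine Finset.sum_congr rfl fun k _ => ?_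
  have hk : (0 : ℤ) ≤ c₃ * k := by positivity
  rw [count₂, backSum_eq_sum_range h₂ (backSum_deltaZero_of_neg c₁) (K := K) (by omega)]
  refine Finset.sum_congr rfl fun j _ => ?_
  have hj : (0 : ℤ) ≤ c₂ * j := by positivity
  rw [backSum_eq_sum_range h₁ deltaZero_of_neg (K := K) (by omega)]
  refine Finset.sum_congr rfl fun i _ => ?_
  rw [deltaZero]
  congr 1
  apply propext
  constructor <;> intro h <;> linarith

end HarmonicCongruence

/-! ### Sums of inverses modulo a prime power -/

namespace HarmonicCongruence

section Ring

theorem ringInverse_neg {R : Type*} [CommRing R] (x : R) : Ring.inverse (-x) = -Ring.inverse x := by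
  rw [neg_eq_neg_one_mul, Ring.inverse_mul (Or.inl isUnit_one.neg)]
  have : Ring.inverse (-1 : R) = -1 := by
    simpa using Ring.inverse_unit (-1 : Rˣ)
  rw [this]
  ring

theorem map_ringInverse_of_isUnit {R S : Type*} [CommRing R] [CommRing S] (f : R →+* S) {x : R}
    (hx : IsUnit x) : f (Ring.inverse x) = Ring.inverse (f x) := by
  have h := congrArg f (Ring.mul_inverse_cancel x hx)
  rw [map_mul, map_one] at h
  calc f (Ring.inverse x) = Ring.inverse (f x) * (f x) * f (Ring.inverse x) := by
        rw [Ring.inverse_mul_cancel _ (hx.map f), one_mul]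
    _ = Ring.inverse (f x) := by rw [mul_assoc, h, mul_one]

end Ring

section PrimePower

variable {p r : ℕ} [hp : Fact p.Prime]

theorem zmod_isUnit_iff (hr : 0 < r) (x : ZMod (p ^ r)) : IsUnit x ↔ ¬ (p : ZMod (p ^ r)) ∣ x := by
  have : NeZero (p ^ r) := ⟨pow_ne_zero _ hp.out.ne_zero⟩
  constructor
  · rintro hx ⟨y, rfl⟩
    have hpu := isUnit_of_mul_isUnit_left hx
    have := (ZMod.isUnit_iff_coprime p (p ^ r)).1 hpu
    rw [Nat.coprime_pow_right_iff hr, Nat.coprime_self] at this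
    exact hp.out.one_lt.ne' this
  · intro hx
    rw [← ZMod.natCast_zmod_val x, ZMod.isUnit_iff_coprime, Nat.coprime_pow_right_iff hr]
    rw [Nat.coprime_comm, hp.out.coprime_iff_not_dvd]
    rintro ⟨y, hy⟩
    exact hx ⟨y, by rw [← Nat.cast_mul, ← hy, ZMod.natCast_zmod_val]⟩

theorem natCast_isUnit_iff (hr : 0 < r) (n : ℕ) : IsUnit (n : ZMod (p ^ r)) ↔ ¬ p ∣ n := by
  rw [ZMod.isUnit_iff_coprime, Nat.coprime_pow_right_iff hr, Nat.coprime_comm,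
    hp.out.coprime_iff_not_dvd]

theorem isUnit_two_of_odd (hr : 0 < r) (hodd : Odd p) : IsUnit (2 : ZMod (p ^ r)) := by
  have h := (natCast_isUnit_iff (p := p) hr 2).2 (fun h => by
    have := (Nat.prime_dvd_prime_iff_eq hp.out Nat.prime_two).1 h
    subst this
    exact absurd hodd (by decide))
  simpa using h

theorem pow_pred_mul_self (hr : 0 < r) : (p : ZMod (p ^ r)) ^ (r - 1) * p = 0 := by
  rw [← pow_succ, Nat.sub_add_cancel hr]
  exact_mod_cast ZMod.natCast_self (p ^ r)

theorem pow_pred_mul_eq_zero (hr : 0 < r) {x : ZMod (p ^ r)} (hx : (p : ZMod (p ^ r)) ∣ x) :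
    (p : ZMod (p ^ r)) ^ (r - 1) * x = 0 := by
  obtain ⟨y, rfl⟩ := hx
  rw [← mul_assoc, pow_pred_mul_self hr, zero_mul]

theorem pow_pred_mul_pow_sub_one (hr : 0 < r) {x : ZMod (p ^ r)} (hx : IsUnit x) :
    (p : ZMod (p ^ r)) ^ (r - 1) * x ^ (p - 1) = (p : ZMod (p ^ r)) ^ (r - 1) := by
  have : NeZero (p ^ r) := ⟨pow_ne_zero _ hp.out.ne_zero⟩
  have h : (p : ZMod (p ^ r)) ∣ x ^ (p - 1) - 1 := by
    have hx' : ¬ p ∣ x.val := by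
      rw [← natCast_isUnit_iff hr, ZMod.natCast_zmod_val]; exact hx
    have hc : IsCoprime (x.val : ℤ) p := by
      rw [Nat.isCoprime_iff_coprime, Nat.coprime_comm]
      exact (hp.out.coprime_iff_not_dvd).2 hx'
    obtain ⟨y, hy⟩ := (Int.modEq_iff_dvd.1 (Int.ModEq.pow_card_sub_one_eq_one hp.out hc).symm)
    refine ⟨(y : ZMod (p ^ r)), ?_⟩
    have := congrArg (fun z : ℤ => (z : ZMod (p ^ r))) hy
    simpa using this
  have := pow_pred_mul_eq_zero hr h
  rw [mul_sub, mul_one, sub_eq_zero] at this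
  exact this

theorem eq_zero_of_eq_neg (hr : 0 < r) (hodd : Odd p) {x : ZMod (p ^ r)} (hx : x = -x) : x = 0 := by
  have h2 : (2 : ZMod (p ^ r)) * x = 0 := by linear_combination hx
  exact (isUnit_two_of_odd hr hodd).mul_right_eq_zero.1 h2

theorem isUnit_of_dvd_sub (hr : 0 < r) {x s : ZMod (p ^ r)} (hs : IsUnit s)
    (h : (p : ZMod (p ^ r)) ∣ x - s) : IsUnit x := by
  rw [zmod_isUnit_iff hr] at hs ⊢
  intro hx
  exact hs (by simpa using dvd_sub hx h)

theorem dvd_ringInverse_sub (hr : 0 < r) {x s : ZMod (p ^ r)} (hs : IsUnit s)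
    (h : (p : ZMod (p ^ r)) ∣ x - s) :
    (p : ZMod (p ^ r)) ∣ Ring.inverse x - Ring.inverse s := by
  have hx := isUnit_of_dvd_sub hr hs h
  have e : Ring.inverse x - Ring.inverse s = (x - s) * (-(Ring.inverse x * Ring.inverse s)) := by
    linear_combination (-Ring.inverse x) * Ring.mul_inverse_cancel s hs
      + Ring.inverse s * Ring.mul_inverse_cancel x hx
  rw [e]
  exact h.mul_right _

variable [NeZero (p ^ r)]

open scoped Classical in
theorem card_nonunits (hr : 0 < r) :
    (Finset.univ.filter fun x : ZMod (p ^ r) => (p : ZMod (p ^ r)) ∣ x).card = p ^ (r - 1) := by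
  have h1 : (Finset.univ.filter fun x : ZMod (p ^ r) => IsUnit x).card = p ^ (r - 1) * (p - 1) := by
    rw [← Nat.totient_prime_pow hp.out hr, ← ZMod.card_units_eq_totient, ← Finset.card_univ]
    symm
    refine Finset.card_bij (fun u _ => (u : ZMod (p ^ r))) ?_ ?_ ?_
    · intro u _; simp
    · intro u _ v _ h; exact Units.ext h
    · intro x hx
      obtain ⟨u, rfl⟩ := (Finset.mem_filter.1 hx).2
      exact ⟨u, Finset.mem_univ _, rfl⟩
  have h2 := Finset.card_filter_add_card_filter_not (s := (Finset.univ : Finset (ZMod (p ^ r))))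
    (fun x => (p : ZMod (p ^ r)) ∣ x)
  have h3 : (Finset.univ.filter fun x : ZMod (p ^ r) => ¬ (p : ZMod (p ^ r)) ∣ x)
      = Finset.univ.filter fun x : ZMod (p ^ r) => IsUnit x := by
    ext x; simp [zmod_isUnit_iff hr]
  rw [h3, h1, Finset.card_univ, ZMod.card] at h2
  obtain ⟨s, rfl⟩ : ∃ s, r = s + 1 := ⟨r - 1, by omega⟩
  obtain ⟨d, hd⟩ : ∃ d, p = d + 1 := ⟨p - 1, by have := hp.out.pos; omega⟩
  have e : p ^ (s + 1) = p ^ s + p ^ s * (p - 1) := by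
    rw [hd, Nat.add_sub_cancel, pow_succ]; ring
  rw [Nat.add_sub_cancel] at *
  omega

open scoped Classical in
theorem sum_dvd_sub (hr : 0 < r) (hodd : Odd p) (s : ZMod (p ^ r)) :
    ∑ x : ZMod (p ^ r) with (p : ZMod (p ^ r)) ∣ x - s, x = (p : ZMod (p ^ r)) ^ (r - 1) * s := by
  have h0 : ∑ x : ZMod (p ^ r) with (p : ZMod (p ^ r)) ∣ x, x = 0 := by
    apply eq_zero_of_eq_neg hr hodd
    rw [← Finset.sum_neg_distrib]
    exact Finset.sum_bij' (fun x _ => -x) (fun x _ => -x) (by simp) (by simp) (by simp) (by simp)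
      (by simp)
  calc _ = ∑ x : ZMod (p ^ r) with (p : ZMod (p ^ r)) ∣ x, (x + s) :=
        Finset.sum_bij' (fun x _ => x - s) (fun x _ => x + s) (by simp) (by simp) (by simp) (by simp)
          (by simp)
    _ = _ := by
        rw [Finset.sum_add_distrib, h0, Finset.sum_const, card_nonunits hr, nsmul_eq_mul, zero_add]
        push_cast
        rfl

open scoped Classical in
-- Inversion carries the residue class of s mod p bijectively onto that of 1/s, so this is
-- `sum_dvd_sub` for 1/s.
theorem sum_ringInverse_dvd_sub (hr : 0 < r) (hodd : Odd p) {s : ZMod (p ^ r)} (hs : IsUnit s) :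
    ∑ x : ZMod (p ^ r) with (p : ZMod (p ^ r)) ∣ x - s, Ring.inverse x
      = (p : ZMod (p ^ r)) ^ (r - 1) * Ring.inverse s := by
  rw [← sum_dvd_sub hr hodd]
  have h1 : ∀ x s : ZMod (p ^ r), IsUnit s → (p : ZMod (p ^ r)) ∣ x - s → IsUnit x :=
    fun x s hs h => isUnit_of_dvd_sub hr hs h
  refine Finset.sum_bij' (fun x _ => Ring.inverse x) (fun x _ => Ring.inverse x) ?_ ?_ ?_ ?_ ?_
  · intro x hx
    simp only [Finset.mem_filter, Finset.mem_univ, true_and] at hx ⊢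
    exact dvd_ringInverse_sub hr hs hx
  · intro x hx
    simp only [Finset.mem_filter, Finset.mem_univ, true_and] at hx ⊢
    have := dvd_ringInverse_sub hr hs.ringInverse hx
    rwa [Ring.inverse_inverse hs] at this
  · intro x hx
    simp only [Finset.mem_filter, Finset.mem_univ, true_and] at hx
    exact Ring.inverse_inverse (h1 _ _ hs hx)
  · intro x hx
    simp only [Finset.mem_filter, Finset.mem_univ, true_and] at hx
    exact Ring.inverse_inverse (h1 _ _ hs.ringInverse hx)
  · intro x _; rfl

theorem sum_odd_eq_zero (hr : 0 < r) (hodd : Odd p) {f : ZMod (p ^ r) → ZMod (p ^ r)}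
    (hf : ∀ x, f (-x) = -f x) : ∑ x, f x = 0 := by
  apply eq_zero_of_eq_neg hr hodd
  rw [← Finset.sum_neg_distrib, ← Equiv.sum_comp (Equiv.neg _)]
  simp [hf]

/-- The involution `b ↦ -(a + b)`. -/
def negAddEquiv {R : Type*} [CommRing R] (a : R) : R ≃ R where
  toFun b := -(a + b)
  invFun b := -(a + b)
  left_inv b := by ring
  right_inv b := by ring

/-- For units with a + b + c = 0 one has 1/(abc) = -(1/b + 1/c)/a². The inverses of all b sum to 0,
and those with c divisible by p, that is b ≡ -a mod p, account for -p^(r-1)/a; the remaining ones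
therefore give p^(r-1)/a, and so do the 1/c by symmetry. -/
theorem ringInverse_mul_sum (hr : 0 < r) (hodd : Odd p) (a : ZMod (p ^ r)) :
    ∑ b, Ring.inverse a * Ring.inverse b * Ring.inverse (-(a + b))
      = -2 * (p : ZMod (p ^ r)) ^ (r - 1) * Ring.inverse a ^ 3 := by
  classical
  by_cases ha : IsUnit a
  swap
  · simp [Ring.inverse_non_unit a ha]
  set g : ZMod (p ^ r) → ZMod (p ^ r) → ZMod (p ^ r) := fun b c =>
    if (p : ZMod (p ^ r)) ∣ c then 0 else Ring.inverse b with hg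
  have h1 : ∑ b, g b (-(a + b)) = (p : ZMod (p ^ r)) ^ (r - 1) * Ring.inverse a := by
    have hs := sum_odd_eq_zero (p := p) hr hodd (f := Ring.inverse) ringInverse_neg
    have hd := sum_ringInverse_dvd_sub hr hodd ha.neg
    rw [← Finset.sum_filter_add_sum_filter_not _ (fun b => (p : ZMod (p ^ r)) ∣ b - -a), hd,
      ringInverse_neg] at hs
    have : ∑ b, g b (-(a + b))
        = ∑ b : ZMod (p ^ r) with ¬ (p : ZMod (p ^ r)) ∣ b - -a, Ring.inverse b := by
      rw [Finset.sum_filter]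
      refine Finset.sum_congr rfl fun b _ => ?_
      have : (p : ZMod (p ^ r)) ∣ -(a + b) ↔ (p : ZMod (p ^ r)) ∣ b - -a := by
        rw [dvd_neg, sub_neg_eq_add, add_comm]
      simp only [hg]
      by_cases h : (p : ZMod (p ^ r)) ∣ b - -a
      · rw [if_pos (this.2 h), if_neg (not_not.2 h)]
      · rw [if_neg (mt this.1 h), if_pos h]
    rw [this]
    linear_combination hs
  have h2 : ∑ b, g (-(a + b)) b = (p : ZMod (p ^ r)) ^ (r - 1) * Ring.inverse a := by
    rw [← h1, ← Equiv.sum_comp (negAddEquiv a)]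
    refine Finset.sum_congr rfl fun b _ => ?_
    change g (-(a + -(a + b))) (-(a + b)) = _
    congr 1
    ring
  have h3 : ∀ b, Ring.inverse a * Ring.inverse b * Ring.inverse (-(a + b))
      = -(Ring.inverse a) ^ 2 * (g b (-(a + b)) + g (-(a + b)) b) := by
    intro b
    set c := -(a + b) with hc
    by_cases hb : (p : ZMod (p ^ r)) ∣ b
    · have hb' : Ring.inverse b = 0 := Ring.inverse_non_unit _ (by rw [zmod_isUnit_iff hr]; simpa)
      simp [hg, hb, hb']
    by_cases hcc : (p : ZMod (p ^ r)) ∣ c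
    · have hc' : Ring.inverse c = 0 := Ring.inverse_non_unit _ (by rw [zmod_isUnit_iff hr]; simpa)
      simp [hg, hcc, hc']
    have eb := Ring.mul_inverse_cancel b ((zmod_isUnit_iff hr _).2 hb)
    have ec := Ring.mul_inverse_cancel c ((zmod_isUnit_iff hr _).2 hcc)
    have ea := Ring.mul_inverse_cancel a ha
    have habc : a + b + c = 0 := by rw [hc]; ring
    simp only [hg, hb, hcc, if_false]
    linear_combination Ring.inverse a ^ 2 * Ring.inverse b * Ring.inverse c * habc
      - Ring.inverse a * Ring.inverse b * Ring.inverse c * ea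
      - Ring.inverse a ^ 2 * Ring.inverse c * eb - Ring.inverse a ^ 2 * Ring.inverse b * ec
  rw [Finset.sum_congr rfl fun b _ => h3 b, ← Finset.mul_sum, Finset.sum_add_distrib, h1, h2]
  ring

/-- The product of the inverses of `a`, `b` and `-(a + b)`. -/
noncomputable def invProd {R : Type*} [CommRing R] (a b : R) : R :=
  Ring.inverse a * Ring.inverse b * Ring.inverse (-(a + b))

theorem invProd_comm {R : Type*} [CommRing R] (a b : R) : invProd a b = invProd b a := by
  rw [invProd, invProd, add_comm b a]; ring

theorem sum_fst_mul_invProd (hr : 0 < r) (hodd : Odd p) (f : ZMod (p ^ r) → ZMod (p ^ r)) :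
    ∑ a, f a * ∑ b, invProd a b
      = -2 * (p : ZMod (p ^ r)) ^ (r - 1) * ∑ a, f a * Ring.inverse a ^ 3 := by
  rw [Finset.mul_sum]
  refine Finset.sum_congr rfl fun a _ => ?_
  have := ringInverse_mul_sum hr hodd a
  simp only [invProd]
  rw [this]
  ring

theorem sum_snd_mul_invProd (hr : 0 < r) (hodd : Odd p) (f : ZMod (p ^ r) → ZMod (p ^ r)) :
    ∑ a, ∑ b, f b * invProd a b
      = -2 * (p : ZMod (p ^ r)) ^ (r - 1) * ∑ a, f a * Ring.inverse a ^ 3 := by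
  rw [Finset.sum_comm, ← sum_fst_mul_invProd hr hodd]
  refine Finset.sum_congr rfl fun b _ => ?_
  rw [Finset.mul_sum]
  exact Finset.sum_congr rfl fun a _ => by rw [invProd_comm]

theorem sum_thd_mul_invProd (hr : 0 < r) (hodd : Odd p) (f : ZMod (p ^ r) → ZMod (p ^ r)) :
    ∑ a, ∑ b, f (-(a + b)) * invProd a b
      = -2 * (p : ZMod (p ^ r)) ^ (r - 1) * ∑ a, f a * Ring.inverse a ^ 3 := by
  rw [← sum_snd_mul_invProd hr hodd]
  refine Finset.sum_congr rfl fun a _ => ?_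
  rw [← Equiv.sum_comp (negAddEquiv a)]
  refine Finset.sum_congr rfl fun b _ => ?_
  have e : negAddEquiv a b = -(a + b) := rfl
  have e' : -(a + -(a + b)) = b := by ring
  rw [e, invProd, invProd, e']
  ring

theorem sum_invProd (hr : 0 < r) (hodd : Odd p) :
    ∑ a : ZMod (p ^ r), ∑ b, invProd a b = 0 := by
  have h := sum_fst_mul_invProd (p := p) hr hodd (fun _ => 1)
  simp only [one_mul] at h
  rw [h, sum_odd_eq_zero hr hodd (f := fun a => Ring.inverse a ^ 3), mul_zero]
  intro x
  rw [ringInverse_neg]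
  ring

end PrimePower

end HarmonicCongruence

/-! ### Reduction to residues and carries -/

namespace HarmonicCongruence

theorem sum_range_mul_eq_sum_zmod {M : Type*} [AddCommMonoid M] (q K : ℕ) [NeZero q] (f : ℕ → M) :
    ∑ i ∈ Finset.range (K * q), f i
      = ∑ a : ZMod q, ∑ u ∈ Finset.range K, f (a.val + q * u) := by
  rw [← Finset.sum_product' (s := Finset.univ) (t := Finset.range K)
    (f := fun a u => f (ZMod.val a + q * u))]
  have hq : 0 < q := Nat.pos_of_ne_zero (NeZero.ne q)
  refine Finset.sum_bij' (fun i _ => ((i : ZMod q), i / q)) (fun x _ => x.1.val + q * x.2)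
    ?_ ?_ ?_ ?_ ?_
  · intro i hi
    simp only [Finset.mem_range, Finset.mem_product, Finset.mem_univ, true_and] at hi ⊢
    exact Nat.div_lt_of_lt_mul (by rwa [mul_comm])
  · rintro ⟨a, u⟩ h
    simp only [Finset.mem_range, Finset.mem_product, Finset.mem_univ, true_and] at h ⊢
    calc a.val + q * u < q + q * u := by have := ZMod.val_lt a; omega
      _ = (u + 1) * q := by ring
      _ ≤ K * q := Nat.mul_le_mul_right _ h
  · intro i _
    simp only [ZMod.val_natCast]
    exact Nat.mod_add_div i q
  · rintro ⟨a, u⟩ _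
    simp only [Prod.mk.injEq]
    constructor
    · simp
    · rw [Nat.add_mul_div_left _ _ hq, Nat.div_eq_of_lt (ZMod.val_lt a), zero_add]
  · intro i _
    simp only [ZMod.val_natCast]
    rw [Nat.mod_add_div i q]

/-- Dividing the equation by q leaves c₁u + c₂v + c₃w = t c₁c₂c₃ - m. The bounds on m required by
`hA` hold since `a.val` is positive and all representatives are below q. -/
theorem sum_fiber_eq {q : ℕ} [NeZero q] {c₁ c₂ c₃ : ℕ} (h₁ : 0 < c₁) (h₂ : 0 < c₂) (h₃ : 0 < c₃)
    {t : ℕ} {A : ℤ} (hA : ∀ m : ℕ, 0 < m → m < c₁ + c₂ + c₃ →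
      count₃ c₁ c₂ c₃ ((t * (c₁ * c₂ * c₃) : ℕ) - m) = A - t * m)
    {a b c : ZMod q} (ha : 0 < a.val) {K : ℕ}
    (hK : t * (c₁ * c₂ * c₃) < K) :
    (∑ u ∈ Finset.range K, ∑ v ∈ Finset.range K, ∑ w ∈ Finset.range K,
      if c₁ * (a.val + q * u) + c₂ * (b.val + q * v) + c₃ * (c.val + q * w)
        = t * (c₁ * c₂ * c₃) * q then (1 : ℤ) else 0)
      = if (c₁ * a + c₂ * b + c₃ * c : ZMod (q)) = 0 then
        A - t * ((c₁ * a.val + c₂ * b.val + c₃ * c.val) / q : ℕ) else 0 := by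
  have hqpos : 0 < q := Nat.pos_of_ne_zero (NeZero.ne q)
  have hcast : ((c₁ * a.val + c₂ * b.val + c₃ * c.val : ℕ) : ZMod q) = c₁ * a + c₂ * b + c₃ * c := by
    push_cast
    simp
  by_cases h : (c₁ * a + c₂ * b + c₃ * c : ZMod q) = 0
  · rw [if_pos h]
    rw [← hcast, ZMod.natCast_eq_zero_iff] at h
    obtain ⟨m, hm⟩ := h
    rw [hm, Nat.mul_div_cancel_left _ hqpos]
    have hal := ZMod.val_lt a
    have hbl := ZMod.val_lt b
    have hcl := ZMod.val_lt c
    have hm0 : 0 < m := by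
      by_contra hm0
      have : m = 0 := by omega
      rw [this, mul_zero] at hm
      have := Nat.mul_pos h₁ ha
      omega
    have hms : m < c₁ + c₂ + c₃ := by
      have e1 := Nat.mul_lt_mul_of_pos_left hal h₁
      have e2 := Nat.mul_lt_mul_of_pos_left hbl h₂
      have e3 := Nat.mul_lt_mul_of_pos_left hcl h₃
      have : q * m < q * (c₁ + c₂ + c₃) := by
        rw [← hm]
        nlinarith
      exact lt_of_mul_lt_mul_left this (Nat.zero_le _)
    rw [← hA m hm0 hms, count₃_eq_sum h₁ h₂ h₃ (K := K) (by omega), Finset.sum_comm]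
    rw [Finset.sum_comm_cycle]
    refine Finset.sum_congr rfl fun k _ => Finset.sum_congr rfl fun j _ =>
      Finset.sum_congr rfl fun i _ => ?_
    congr 1
    apply propext
    have e : c₁ * (a.val + q * i) + c₂ * (b.val + q * j) + c₃ * (c.val + q * k)
        = q * (c₁ * i + c₂ * j + c₃ * k + m) := by
      calc _ = (c₁ * a.val + c₂ * b.val + c₃ * c.val) + q * (c₁ * i + c₂ * j + c₃ * k) := by ring
        _ = _ := by rw [hm]; ring
    rw [e, mul_comm (t * (c₁ * c₂ * c₃)) q]
    rw [Nat.mul_left_cancel_iff hqpos, eq_sub_iff_add_eq]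
    exact_mod_cast Iff.rfl
  · rw [if_neg h]
    refine Finset.sum_eq_zero fun i _ => Finset.sum_eq_zero fun j _ =>
      Finset.sum_eq_zero fun k _ => if_neg fun heq => h ?_
    have := congrArg (fun n : ℕ => (n : ZMod q)) heq
    simpa using this

variable {p r : ℕ} [hp : Fact p.Prime]

/-- `Ring.inverse` is 0 at multiples of p, so positivity and coprimality to p need not be imposed on
the index set. -/
theorem sum_solutions_eq_sum_range (hr : 0 < r) {c₁ c₂ c₃ : ℕ} (h₁ : 0 < c₁) (h₂ : 0 < c₂)
    (h₃ : 0 < c₃) {N K : ℕ} (hK : N < K) :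
    ∑ s ∈ solutions c₁ c₂ c₃ p N, Ring.inverse (s.1 : ZMod (p ^ r)) * Ring.inverse (s.2.1 : ZMod (p ^ r))
        * Ring.inverse (s.2.2 : ZMod (p ^ r))
      = ∑ i ∈ Finset.range K, ∑ j ∈ Finset.range K, ∑ k ∈ Finset.range K,
        if c₁ * i + c₂ * j + c₃ * k = N then
          Ring.inverse (i : ZMod (p ^ r)) * Ring.inverse (j : ZMod (p ^ r))
            * Ring.inverse (k : ZMod (p ^ r)) else 0 := by
  have e : ∀ i : ℕ, ∑ j ∈ Finset.range K, ∑ k ∈ Finset.range K,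
        (if c₁ * i + c₂ * j + c₃ * k = N then
          Ring.inverse (i : ZMod (p ^ r)) * Ring.inverse (j : ZMod (p ^ r))
            * Ring.inverse (k : ZMod (p ^ r)) else 0)
      = ∑ x ∈ Finset.range K ×ˢ Finset.range K, (if c₁ * i + c₂ * x.1 + c₃ * x.2 = N then
          Ring.inverse (i : ZMod (p ^ r)) * Ring.inverse (x.1 : ZMod (p ^ r))
            * Ring.inverse (x.2 : ZMod (p ^ r)) else 0) := fun i => by
    rw [Finset.sum_product]
  rw [Finset.sum_congr rfl fun i _ => e i, ← Finset.sum_product', ← Finset.sum_filter]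
  apply Finset.sum_subset
  · rintro ⟨i, j, k⟩ hs
    simp only [solutions, Finset.mem_filter, Finset.mem_product, Finset.mem_Icc,
      Finset.mem_range] at hs ⊢
    omega
  · rintro ⟨i, j, k⟩ hs hs'
    simp only [Finset.mem_filter, Finset.mem_product, Finset.mem_range] at hs
    rw [mem_solutions h₁ h₂ h₃] at hs'
    by_contra hne
    have hu : ∀ n : ℕ, Ring.inverse (n : ZMod (p ^ r)) ≠ 0 → ¬ p ∣ n := by
      intro n hn hpn
      refine hn (Ring.inverse_non_unit _ ?_)
      rw [natCast_isUnit_iff hr]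
      simpa using hpn
    have hi := hu i (fun h => hne (by simp [h]))
    have hj := hu j (fun h => hne (by simp [h]))
    have hk := hu k (fun h => hne (by simp [h]))
    have hpos : ∀ n : ℕ, ¬ p ∣ n → 1 ≤ n := fun n hn =>
      Nat.one_le_iff_ne_zero.2 fun h => hn (h ▸ dvd_zero p)
    refine hs' ⟨hpos _ hi, hpos _ hj, hpos _ hk, ?_, hs.2⟩
    rw [← Nat.coprime_iff_gcd_eq_one, Nat.coprime_comm, hp.out.coprime_iff_not_dvd]
    rw [hp.out.dvd_mul, hp.out.dvd_mul]
    tauto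

theorem val_pos_of_isUnit (hr : 0 < r) {a : ZMod (p ^ r)} (ha : IsUnit a) : 0 < a.val := by
  rw [Nat.pos_iff_ne_zero, Ne, ZMod.val_eq_zero]
  rintro rfl
  rw [zmod_isUnit_iff hr] at ha
  exact ha (dvd_zero _)

variable [NeZero (p ^ r)]

/-- The carry in multiplying `c⁻¹ a` by `c`, for representatives in `[0, p ^ r)`. -/
noncomputable def mulCarry (p r c : ℕ) (a : ZMod (p ^ r)) : ℕ :=
  c * (Ring.inverse (c : ZMod (p ^ r)) * a).val / p ^ r

/-- The quotient by `p ^ r` of the sum of the representatives of `a`, `b` and `-(a + b)`. -/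
def addCarry {p r : ℕ} (a b : ZMod (p ^ r)) : ℕ := (a.val + b.val + (-(a + b)).val) / p ^ r

theorem mul_val_ringInverse_mul {c : ℕ} (hc : IsUnit (c : ZMod (p ^ r))) (a : ZMod (p ^ r)) :
    c * (Ring.inverse (c : ZMod (p ^ r)) * a).val = a.val + p ^ r * mulCarry p r c a := by
  rw [mulCarry, ← Nat.mod_add_div (c * (Ring.inverse (c : ZMod (p ^ r)) * a).val) (p ^ r)]
  congr 1
  · rw [← ZMod.val_natCast]
    push_cast
    rw [ZMod.natCast_zmod_val, ← mul_assoc, Ring.mul_inverse_cancel _ hc, one_mul]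
  · rw [Nat.mod_add_div]

theorem addCarry_mul (a b : ZMod (p ^ r)) :
    a.val + b.val + (-(a + b)).val = p ^ r * addCarry a b := by
  rw [addCarry, Nat.mul_div_cancel']
  rw [← ZMod.natCast_eq_zero_iff]
  push_cast
  simp

theorem carry_eq {c₁ c₂ c₃ : ℕ} (u₁ : IsUnit (c₁ : ZMod (p ^ r))) (u₂ : IsUnit (c₂ : ZMod (p ^ r)))
    (u₃ : IsUnit (c₃ : ZMod (p ^ r))) (a b : ZMod (p ^ r)) :
    (c₁ * (Ring.inverse (c₁ : ZMod (p ^ r)) * a).val + c₂ * (Ring.inverse (c₂ : ZMod (p ^ r)) * b).val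
      + c₃ * (Ring.inverse (c₃ : ZMod (p ^ r)) * -(a + b)).val) / p ^ r
      = mulCarry p r c₁ a + mulCarry p r c₂ b + mulCarry p r c₃ (-(a + b)) + addCarry a b := by
  rw [mul_val_ringInverse_mul u₁, mul_val_ringInverse_mul u₂, mul_val_ringInverse_mul u₃]
  apply Nat.div_eq_of_eq_mul_right (Nat.pos_of_ne_zero (NeZero.ne _))
  have := addCarry_mul a b
  linear_combination this

theorem sum_solutions_eq_sum_zmod (hr : 0 < r) {c₁ c₂ c₃ : ℕ} (h₁ : 0 < c₁) (h₂ : 0 < c₂)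
    (h₃ : 0 < c₃) {t : ℕ} {A : ℤ} (hA : ∀ m : ℕ, 0 < m → m < c₁ + c₂ + c₃ →
      count₃ c₁ c₂ c₃ ((t * (c₁ * c₂ * c₃) : ℕ) - m) = A - t * m) :
    ∑ s ∈ solutions c₁ c₂ c₃ p (t * (c₁ * c₂ * c₃) * p ^ r), Ring.inverse (s.1 : ZMod (p ^ r))
        * Ring.inverse (s.2.1 : ZMod (p ^ r)) * Ring.inverse (s.2.2 : ZMod (p ^ r))
      = ∑ a : ZMod (p ^ r), ∑ b : ZMod (p ^ r), ∑ c : ZMod (p ^ r),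
        if c₁ * a + c₂ * b + c₃ * c = 0 then
          Ring.inverse a * Ring.inverse b * Ring.inverse c
            * (A - t * ((c₁ * a.val + c₂ * b.val + c₃ * c.val) / p ^ r : ℕ)) else 0 := by
  have hq : 0 < p ^ r := Nat.pos_of_ne_zero (NeZero.ne _)
  set K := t * (c₁ * c₂ * c₃) + 1 with hK
  rw [sum_solutions_eq_sum_range hr h₁ h₂ h₃ (K := K * p ^ r)
    (Nat.mul_lt_mul_of_pos_right (Nat.lt_succ_self _) hq)]
  simp only [sum_range_mul_eq_sum_zmod]
  refine Finset.sum_congr rfl fun a _ => ?_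
  rw [Finset.sum_comm]
  refine Finset.sum_congr rfl fun b _ => ?_
  rw [Finset.sum_comm_cycle]
  refine Finset.sum_congr rfl fun c _ => ?_
  have hcast : ∀ (x : ZMod (p ^ r)) (n : ℕ), ((x.val + p ^ r * n : ℕ) : ZMod (p ^ r)) = x := by
    intro x n
    rw [Nat.cast_add, Nat.cast_mul, ZMod.natCast_self, zero_mul, add_zero, ZMod.natCast_zmod_val]
  simp only [hcast]
  -- For a nonunit a, where `a.val` may be 0, both sides vanish.
  by_cases ha : IsUnit a
  swap
  · simp [Ring.inverse_non_unit a ha]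
  have h := congrArg (fun n : ℤ => Ring.inverse a * Ring.inverse b * Ring.inverse c * (n : ZMod (p ^ r)))
    (sum_fiber_eq h₁ h₂ h₃ hA (a := a) (b := b) (c := c) (val_pos_of_isUnit hr ha)
      (Nat.lt_succ_self _))
  simp only [Int.cast_sum, Int.cast_ite, Int.cast_one, Int.cast_zero, Finset.mul_sum, mul_ite,
    mul_one, mul_zero, Int.cast_sub, Int.cast_mul, Int.cast_natCast] at h
  exact h

theorem ringInverse_mul_left {R : Type*} [CommRing R] {x : R} (hx : IsUnit x) (y : R) :
    Ring.inverse (Ring.inverse x * y) = x * Ring.inverse y := by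
  rw [Ring.inverse_mul (Or.inl hx.ringInverse), Ring.inverse_inverse hx, mul_comm]

theorem sum_ringInverse_smul {R M : Type*} [CommRing R] [Fintype R] [AddCommMonoid M] {x : R}
    (hx : IsUnit x) (f : R → M) : ∑ y, f (Ring.inverse x * y) = ∑ y, f y := by
  obtain ⟨u, hu⟩ := hx.ringInverse
  rw [← hu]
  exact Equiv.sum_comp (Units.mulLeft u) f

theorem sum_ringInverse_smul₃ {R M : Type*} [CommRing R] [Fintype R] [AddCommMonoid M] {x y z : R}
    (hx : IsUnit x) (hy : IsUnit y) (hz : IsUnit z) (f : R → R → R → M) :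
    ∑ a, ∑ b, ∑ c, f (Ring.inverse x * a) (Ring.inverse y * b) (Ring.inverse z * c)
      = ∑ a, ∑ b, ∑ c, f a b c := by
  rw [← sum_ringInverse_smul hx fun a => ∑ b, ∑ c, f a b c]
  refine Finset.sum_congr rfl fun a _ => ?_
  rw [← sum_ringInverse_smul hy fun b => ∑ c, f _ b c]
  exact Finset.sum_congr rfl fun b _ => sum_ringInverse_smul hz _

/-- The sum over solutions, split into contributions of the carries. -/
theorem sum_solutions_eq_carries (hr : 0 < r) (hodd : Odd p) {c₁ c₂ c₃ : ℕ} (h₁ : 0 < c₁)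
    (h₂ : 0 < c₂) (h₃ : 0 < c₃) (h₁₂ : Nat.Coprime c₁ c₂) (h₁₃ : Nat.Coprime c₁ c₃)
    (h₂₃ : Nat.Coprime c₂ c₃) (u₁ : IsUnit (c₁ : ZMod (p ^ r))) (u₂ : IsUnit (c₂ : ZMod (p ^ r)))
    (u₃ : IsUnit (c₃ : ZMod (p ^ r))) (t : ℕ) :
    ∑ s ∈ solutions c₁ c₂ c₃ p (t * (c₁ * c₂ * c₃) * p ^ r), Ring.inverse (s.1 : ZMod (p ^ r))
        * Ring.inverse (s.2.1 : ZMod (p ^ r)) * Ring.inverse (s.2.2 : ZMod (p ^ r))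
      = -(t * (c₁ * c₂ * c₃) : ZMod (p ^ r)) *
        (∑ a, ∑ b, (addCarry a b : ZMod (p ^ r)) * invProd a b
          - 2 * p ^ (r - 1) * (∑ a, mulCarry p r c₁ a * Ring.inverse a ^ 3
            + ∑ a, mulCarry p r c₂ a * Ring.inverse a ^ 3
            + ∑ a, mulCarry p r c₃ a * Ring.inverse a ^ 3)) := by
  obtain ⟨A, hA⟩ := exists_count₃_eq h₁ h₂ h₃ h₁₂ h₁₃ h₂₃ t
  rw [sum_solutions_eq_sum_zmod hr h₁ h₂ h₃ hA]
  have e1 : ∀ a b c : ZMod (p ^ r), (if c₁ * (Ring.inverse (c₁ : ZMod (p ^ r)) * a)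
        + c₂ * (Ring.inverse (c₂ : ZMod (p ^ r)) * b) + c₃ * (Ring.inverse (c₃ : ZMod (p ^ r)) * c) = 0
      then Ring.inverse (Ring.inverse (c₁ : ZMod (p ^ r)) * a)
          * Ring.inverse (Ring.inverse (c₂ : ZMod (p ^ r)) * b)
          * Ring.inverse (Ring.inverse (c₃ : ZMod (p ^ r)) * c)
          * (A - t * ((c₁ * (Ring.inverse (c₁ : ZMod (p ^ r)) * a).val
            + c₂ * (Ring.inverse (c₂ : ZMod (p ^ r)) * b).val
            + c₃ * (Ring.inverse (c₃ : ZMod (p ^ r)) * c).val) / p ^ r : ℕ)) else 0)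
      = if c = -(a + b) then (c₁ * c₂ * c₃ : ZMod (p ^ r)) * invProd a b * (A - t *
        (mulCarry p r c₁ a + mulCarry p r c₂ b + mulCarry p r c₃ (-(a + b)) + addCarry a b : ℕ))
        else 0 := by
    intro a b c
    have hiff : c₁ * (Ring.inverse (c₁ : ZMod (p ^ r)) * a)
        + c₂ * (Ring.inverse (c₂ : ZMod (p ^ r)) * b) + c₃ * (Ring.inverse (c₃ : ZMod (p ^ r)) * c) = 0
        ↔ c = -(a + b) := by
      rw [Ring.mul_inverse_cancel_left _ _ u₁, Ring.mul_inverse_cancel_left _ _ u₂,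
        Ring.mul_inverse_cancel_left _ _ u₃, add_comm, eq_neg_iff_add_eq_zero]
    by_cases h : c = -(a + b)
    · rw [if_pos (hiff.2 h), if_pos h, h, carry_eq u₁ u₂ u₃, ringInverse_mul_left u₁,
        ringInverse_mul_left u₂, ringInverse_mul_left u₃, invProd]
      ring
    · rw [if_neg (mt hiff.1 h), if_neg h]
  refine (sum_ringInverse_smul₃ u₁ u₂ u₃ _).symm.trans ?_
  simp only [e1, Finset.sum_ite_eq', Finset.mem_univ, if_true]
  have e2 : ∀ a b : ZMod (p ^ r), (c₁ * c₂ * c₃ : ZMod (p ^ r)) * invProd a b * (A - t *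
        (mulCarry p r c₁ a + mulCarry p r c₂ b + mulCarry p r c₃ (-(a + b)) + addCarry a b : ℕ))
      = (c₁ * c₂ * c₃ : ZMod (p ^ r)) * A * invProd a b
        + -(t * (c₁ * c₂ * c₃) : ZMod (p ^ r)) * (mulCarry p r c₁ a * invProd a b)
        + -(t * (c₁ * c₂ * c₃) : ZMod (p ^ r)) * (mulCarry p r c₂ b * invProd a b)
        + -(t * (c₁ * c₂ * c₃) : ZMod (p ^ r)) * (mulCarry p r c₃ (-(a + b)) * invProd a b)
        + -(t * (c₁ * c₂ * c₃) : ZMod (p ^ r)) * (addCarry a b * invProd a b) := by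
    intro a b
    push_cast
    ring
  simp only [e2, Finset.sum_add_distrib, ← Finset.mul_sum]
  -- The term with A drops out; each multiplication carry depends on one variable, so the other is
  -- summed away.
  rw [sum_invProd hr hodd, sum_fst_mul_invProd hr hodd (fun a => (mulCarry p r c₁ a : ZMod (p ^ r))),
    sum_snd_mul_invProd hr hodd (fun a => (mulCarry p r c₂ a : ZMod (p ^ r))),
    sum_thd_mul_invProd hr hodd (fun a => (mulCarry p r c₃ a : ZMod (p ^ r)))]
  ring

/-- The doubling relation for the contribution of the additive carry. -/
theorem six_mul_sum_addCarry (hr : 0 < r) (hodd : Odd p) :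
    6 * ∑ a : ZMod (p ^ r), ∑ b, (addCarry a b : ZMod (p ^ r)) * invProd a b
      = 48 * p ^ (r - 1) * ∑ a, (mulCarry p r 2 a : ZMod (p ^ r)) * Ring.inverse a ^ 3 := by
  have u : IsUnit ((2 : ℕ) : ZMod (p ^ r)) := by exact_mod_cast isUnit_two_of_odd hr hodd
  -- This is `carry_eq` with all coefficients 2: the halves of a, b and -(a + b) again sum to 0, so
  -- the left side is twice their addition carry.
  have hcarry : ∀ a b : ZMod (p ^ r), 2 * addCarry (Ring.inverse ((2 : ℕ) : ZMod (p ^ r)) * a)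
        (Ring.inverse ((2 : ℕ) : ZMod (p ^ r)) * b)
      = mulCarry p r 2 a + mulCarry p r 2 b + mulCarry p r 2 (-(a + b)) + addCarry a b := by
    intro a b
    rw [← carry_eq u u u, ← mul_add, ← mul_add]
    have e : Ring.inverse ((2 : ℕ) : ZMod (p ^ r)) * -(a + b)
        = -(Ring.inverse ((2 : ℕ) : ZMod (p ^ r)) * a + Ring.inverse ((2 : ℕ) : ZMod (p ^ r)) * b) := by
      ring
    rw [e, addCarry_mul, mul_left_comm, Nat.mul_div_cancel_left _ (Nat.pos_of_ne_zero (NeZero.ne _))]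
  have hprod : ∀ a b : ZMod (p ^ r), invProd (Ring.inverse ((2 : ℕ) : ZMod (p ^ r)) * a)
      (Ring.inverse ((2 : ℕ) : ZMod (p ^ r)) * b) = 8 * invProd a b := by
    intro a b
    have e : -(Ring.inverse ((2 : ℕ) : ZMod (p ^ r)) * a + Ring.inverse ((2 : ℕ) : ZMod (p ^ r)) * b)
        = Ring.inverse ((2 : ℕ) : ZMod (p ^ r)) * -(a + b) := by ring
    rw [invProd, e, ringInverse_mul_left u, ringInverse_mul_left u, ringInverse_mul_left u, invProd]
    push_cast
    ring
  set E := ∑ a : ZMod (p ^ r), ∑ b, (addCarry a b : ZMod (p ^ r)) * invProd a b with hE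
  have h1 : 2 * E = ∑ a : ZMod (p ^ r), ∑ b,
      8 * ((mulCarry p r 2 a : ZMod (p ^ r)) * invProd a b + mulCarry p r 2 b * invProd a b
        + mulCarry p r 2 (-(a + b)) * invProd a b + addCarry a b * invProd a b) := by
    rw [hE, ← sum_ringInverse_smul u, Finset.mul_sum]
    refine Finset.sum_congr rfl fun a _ => ?_
    rw [← sum_ringInverse_smul u, Finset.mul_sum]
    refine Finset.sum_congr rfl fun b _ => ?_
    have := congrArg (fun n : ℕ => (n : ZMod (p ^ r))) (hcarry a b)
    simp only [Nat.cast_add, Nat.cast_mul, Nat.cast_ofNat] at this hprod ⊢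
    rw [hprod]
    linear_combination 8 * invProd a b * this
  simp only [← Finset.mul_sum, Finset.sum_add_distrib] at h1
  rw [← hE, sum_fst_mul_invProd hr hodd (fun a => (mulCarry p r 2 a : ZMod (p ^ r))),
    sum_snd_mul_invProd hr hodd (fun a => (mulCarry p r 2 a : ZMod (p ^ r))),
    sum_thd_mul_invProd hr hodd (fun a => (mulCarry p r 2 a : ZMod (p ^ r)))] at h1
  -- With M the sum for `mulCarry p r 2`, `h1` reads 2E = 8(E - 6p^(r-1) M).
  linear_combination -h1

end HarmonicCongruence

/-! ### Voronoi's congruence and Bernoulli numbers -/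

namespace HarmonicCongruence

/-- Voronoi's congruence for power sums. -/
theorem voronoi_power_sum {q c : ℕ} (hq : 0 < q) (hc : Nat.Coprime c q) (e : ℕ) :
    (q : ℤ) ^ 2 ∣ (e + 1) * q * c ^ e * (∑ x ∈ Finset.range q, (c * x / q : ℕ) * (x : ℤ) ^ e)
      - (c ^ (e + 1) - 1) * ∑ x ∈ Finset.range q, (x : ℤ) ^ (e + 1) := by
  have : NeZero q := ⟨hq.ne'⟩
  have hperm : ∑ x ∈ Finset.range q, ((c * x % q : ℕ) : ℤ) ^ (e + 1)
      = ∑ x ∈ Finset.range q, (x : ℤ) ^ (e + 1) := by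
    have h (f : ℕ → ℤ) : ∑ x ∈ Finset.range q, f x = ∑ a : ZMod q, f a.val := by
      have := sum_range_mul_eq_sum_zmod q 1 f
      simpa using this
    rw [h, h]
    symm
    rw [← Equiv.sum_comp (Units.mulLeft (ZMod.unitOfCoprime c hc))]
    refine Finset.sum_congr rfl fun a _ => ?_
    rw [← ZMod.val_natCast]
    simp
  -- Expand (cx - q⌊cx/q⌋)^(e+1) to first order in q.
  have hterm : ∀ x : ℕ, (q : ℤ) ^ 2 ∣ ((c * x % q : ℕ) : ℤ) ^ (e + 1)
      - (c ^ (e + 1) * (x : ℤ) ^ (e + 1) - (e + 1) * q * c ^ e * ((c * x / q : ℕ) * (x : ℤ) ^ e)) := by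
    intro x
    obtain ⟨k, hk⟩ := Polynomial.powAddExpansion ((c * x : ℕ) : ℤ) (-(q * (c * x / q : ℕ))) (e + 1)
    have hmod : ((c * x % q : ℕ) : ℤ) = ((c * x : ℕ) : ℤ) + (-(q * (c * x / q : ℕ))) := by
      have := Nat.mod_add_div (c * x) q
      have := congrArg (fun n : ℕ => (n : ℤ)) this
      simp only [Nat.cast_add, Nat.cast_mul] at this ⊢
      linarith
    refine ⟨k * ((c * x / q : ℕ) : ℤ) ^ 2, ?_⟩
    rw [hmod, hk]
    simp only [Nat.add_sub_cancel]
    push_cast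
    ring
  have hsum := Finset.dvd_sum fun x (_ : x ∈ Finset.range q) => hterm x
  rw [Finset.sum_sub_distrib, hperm, Finset.sum_sub_distrib, ← Finset.mul_sum, ← Finset.mul_sum] at hsum
  obtain ⟨k, hk⟩ := hsum
  exact ⟨k, by linear_combination hk⟩

variable {p r : ℕ} [hp : Fact p.Prime]

/-- The factor p^(r-1) makes only residues mod p matter, so Fermat applies. At nonunits both sides
vanish only because e > 0: hence e = p - 4, k = 1 for p ≥ 5, but e = 1, k = 2 for p = 3. -/
theorem pow_pred_mul_ringInverse_pow (hr : 0 < r) {e k : ℕ} (he : 0 < e) (hek : e + 3 = (p - 1) * k)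
    (x : ZMod (p ^ r)) :
    (p : ZMod (p ^ r)) ^ (r - 1) * Ring.inverse x ^ 3 = (p : ZMod (p ^ r)) ^ (r - 1) * x ^ e := by
  by_cases hx : IsUnit x
  · have h : ∀ k : ℕ, (p : ZMod (p ^ r)) ^ (r - 1) * x ^ ((p - 1) * k)
        = (p : ZMod (p ^ r)) ^ (r - 1) := by
      intro k
      induction k with
      | zero => simp
      | succ k ih => rw [mul_add, mul_one, pow_add, ← mul_assoc, ih, pow_pred_mul_pow_sub_one hr hx]
    have h3 : x ^ 3 * Ring.inverse x ^ 3 = 1 := by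
      rw [← mul_pow, Ring.mul_inverse_cancel _ hx, one_pow]
    rw [← h k, ← hek, pow_add]
    have := h k
    rw [← hek, pow_add] at this
    linear_combination ((p : ZMod (p ^ r)) ^ (r - 1) * x ^ e) * h3 - x ^ e * this
  · rw [Ring.inverse_non_unit x hx, zero_pow (by norm_num), mul_zero]
    rw [zmod_isUnit_iff hr, not_not] at hx
    rw [pow_pred_mul_eq_zero hr (dvd_pow hx he.ne')]

theorem pow_pred_mul_sum_mulCarry [NeZero (p ^ r)] (hr : 0 < r) {e k : ℕ} (he : 0 < e)
    (hek : e + 3 = (p - 1) * k) {c : ℕ} (hc : IsUnit (c : ZMod (p ^ r))) :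
    (p : ZMod (p ^ r)) ^ (r - 1) * ∑ a, (mulCarry p r c a : ZMod (p ^ r)) * Ring.inverse a ^ 3
      = (p : ZMod (p ^ r)) ^ (r - 1) * (c ^ e
        * ((∑ x ∈ Finset.range (p ^ r), (c * x / p ^ r : ℕ) * (x : ℤ) ^ e : ℤ) : ZMod (p ^ r))) := by
  have h1 := sum_ringInverse_smul (hc.ringInverse) fun a =>
    (mulCarry p r c a : ZMod (p ^ r)) * Ring.inverse a ^ 3
  have h2 := sum_range_mul_eq_sum_zmod (p ^ r) 1 fun x =>
    ((c * x / p ^ r : ℕ) : ZMod (p ^ r)) * (x : ZMod (p ^ r)) ^ e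
  simp only [one_mul, Finset.range_one, Finset.sum_singleton, mul_zero, add_zero] at h2
  simp only [Int.cast_sum, Int.cast_mul, Int.cast_natCast, Int.cast_pow]
  rw [← h1, h2]
  simp only [Finset.mul_sum]
  refine Finset.sum_congr rfl fun a _ => ?_
  rw [Ring.inverse_inverse hc, mulCarry, Ring.inverse_mul_cancel_left _ _ hc, ZMod.natCast_zmod_val]
  have := pow_pred_mul_ringInverse_pow hr he hek (c * a)
  rw [mul_pow] at this
  linear_combination ((c * a.val / p ^ r : ℕ) : ZMod (p ^ r)) * this

theorem pow_pred_mul_intCast_eq_zero (hr : 0 < r) {z : ℤ} (hz : (p : ℤ) ∣ z) :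
    (p : ZMod (p ^ r)) ^ (r - 1) * (z : ZMod (p ^ r)) = 0 := by
  obtain ⟨y, rfl⟩ := hz
  exact pow_pred_mul_eq_zero hr ⟨y, by push_cast; rfl⟩

theorem six_mul_sum_range_sq (q : ℕ) :
    6 * ∑ x ∈ Finset.range q, (x : ℤ) ^ 2 = (q - 1) * q * (2 * q - 1) := by
  induction q with
  | zero => simp
  | succ q ih =>
    rw [Finset.sum_range_succ, mul_add, ih]
    push_cast
    ring

theorem pow_pred_mul_sum_mulCarry_three {r : ℕ} [NeZero (3 ^ r)] (hr : 0 < r) {c : ℕ}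
    (hc : IsUnit (c : ZMod (3 ^ r))) {d : ℤ} (hd : (c : ℤ) ^ 2 = 1 + 3 * d) :
    (3 : ZMod (3 ^ r)) ^ (r - 1) * ∑ a, (mulCarry 3 r c a : ZMod (3 ^ r)) * Ring.inverse a ^ 3
      = 3 ^ (r - 1) * d := by
  have : Fact (Nat.Prime 3) := ⟨Nat.prime_three⟩
  have h := pow_pred_mul_sum_mulCarry (p := 3) (e := 1) (k := 2) hr one_pos rfl hc
  simp only [Nat.cast_ofNat] at h
  rw [h]
  set V : ℤ := ∑ x ∈ Finset.range (3 ^ r), (c * x / 3 ^ r : ℕ) * (x : ℤ) ^ 1 with hV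
  obtain ⟨w, hw⟩ := voronoi_power_sum (q := 3 ^ r) (by positivity) ((ZMod.isUnit_iff_coprime _ _).1 hc) 1
  rw [← hV] at hw
  have hS := six_mul_sum_range_sq (3 ^ r)
  simp only [Nat.reduceAdd] at hw
  set S : ℤ := ∑ x ∈ Finset.range (3 ^ r), (x : ℤ) ^ 2
  obtain ⟨s, rfl⟩ : ∃ s, r = s + 1 := ⟨r - 1, by omega⟩
  push_cast at hw hS
  have hq : (3 : ℤ) ^ (s + 1) ≠ 0 := by positivity
  -- Voronoi's congruence with e = 1 and the closed form of the sum of squares. The 3 in c² - 1 = 3d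
  -- allows division by 3q, and modulo 3 what remains is cV ≡ d.
  have key : 3 * ((3 : ℤ) ^ (s + 1)) * (4 * (c * V))
      = 3 * (3 : ℤ) ^ (s + 1) * (d * (3 ^ (s + 1) - 1) * (2 * 3 ^ (s + 1) - 1) + 2 * 3 ^ (s + 1) * w) := by
    linear_combination 6 * hw + (c ^ 2 - 1) * hS
      + (3 ^ (s + 1) - 1) * 3 ^ (s + 1) * (2 * 3 ^ (s + 1) - 1) * hd
  have key2 := mul_left_cancel₀ (mul_ne_zero (by norm_num) hq) key
  have hdvd : ((3 : ℕ) : ℤ) ∣ c * V - d :=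
    ⟨3 ^ s * (d * (2 * 3 ^ (s + 1) - 3) + 2 * w) - c * V, by
      push_cast
      linear_combination key2⟩
  have := pow_pred_mul_intCast_eq_zero (p := 3) hr hdvd
  push_cast at this
  push_cast [hV]
  push_cast [hV] at this
  linear_combination this

/-- In the recursion for the Bernoulli numbers the coefficient of B_i is i + 1, a p-adic unit when i
+ 1 < p. -/
theorem exists_padicInt_bernoulli {i : ℕ} (hi : i + 1 < p) :
    ∃ b : ℤ_[p], (b : ℚ_[p]) = (bernoulli i : ℚ) := by
  suffices h : ‖((bernoulli i : ℚ) : ℚ_[p])‖ ≤ 1 from ⟨⟨_, h⟩, rfl⟩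
  induction i using Nat.strong_induction_on with
  | _ i ih =>
    have h := sum_bernoulli (i + 1)
    rw [Finset.sum_range_succ, Nat.choose_succ_self_right] at h
    have h' := congrArg (fun x : ℚ => (x : ℚ_[p])) h
    simp only [Rat.cast_add, Rat.cast_mul, Rat.cast_sum, Rat.cast_natCast] at h'
    have hn : ‖((i + 1 : ℕ) : ℚ_[p]) * (bernoulli i : ℚ)‖ ≤ 1 := by
      rw [← eq_sub_iff_add_eq'] at h'
      rw [h']
      rw [sub_eq_add_neg]
      refine (IsUltrametricDist.norm_add_le_max _ _).trans (max_le ?_ ?_)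
      · split_ifs <;> simp
      · rw [norm_neg]
        refine IsUltrametricDist.norm_sum_le_of_forall_le_of_nonneg zero_le_one fun j hj => ?_
        have hj : j < i := by simpa using hj
        rw [norm_mul]
        exact mul_le_one₀ (by simpa using Padic.norm_int_le_one (p := p) ((i + 1).choose j : ℤ)) (norm_nonneg _)
          (ih j hj (by omega))
    have hi1 : ‖((i + 1 : ℕ) : ℚ_[p])‖ = 1 := by
      rw [Padic.norm_natCast_eq_one_iff, hp.out.coprime_iff_not_dvd]
      exact Nat.not_dvd_of_pos_of_lt i.succ_pos hi
    rwa [norm_mul, hi1, one_mul] at hn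

theorem padicInt_natCast_isUnit_iff (n : ℕ) : IsUnit (n : ℤ_[p]) ↔ ¬ p ∣ n := by
  rw [PadicInt.isUnit_iff, PadicInt.norm_natCast_eq_one_iff, hp.out.coprime_iff_not_dvd]

theorem coe_ringInverse {x : ℤ_[p]} (hx : IsUnit x) :
    ((Ring.inverse x : ℤ_[p]) : ℚ_[p]) = (x : ℚ_[p])⁻¹ := by
  apply eq_inv_of_mul_eq_one_left
  rw [← PadicInt.coe_mul, Ring.inverse_mul_cancel _ hx, PadicInt.coe_one]

/-- In Faulhaber's formula every term other than q B_n is divisible by q², and the denominator n + 1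
is a unit. -/
theorem exists_sum_range_pow_eq {n : ℕ} (hn : n + 1 < p) {b : ℤ_[p]}
    (hb : (b : ℚ_[p]) = (bernoulli n : ℚ)) (q : ℕ) :
    ∃ z : ℤ_[p], ∑ x ∈ Finset.range q, (x : ℤ_[p]) ^ n = q * (b + q * z) := by
  have hB : ∀ i : ℕ, ∃ β : ℤ_[p], i ≤ n → (β : ℚ_[p]) = (bernoulli i : ℚ) := by
    intro i
    by_cases hi : i ≤ n
    · obtain ⟨β, hβ⟩ := exists_padicInt_bernoulli (p := p) (i := i) (by omega)
      exact ⟨β, fun _ => hβ⟩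
    · exact ⟨0, fun h => absurd h hi⟩
  choose β hβ using hB
  have hu : IsUnit ((n + 1 : ℕ) : ℤ_[p]) :=
    (padicInt_natCast_isUnit_iff _).2 (Nat.not_dvd_of_pos_of_lt n.succ_pos hn)
  have hn0 : ((n : ℚ_[p]) + 1) ≠ 0 := by exact_mod_cast n.succ_ne_zero
  refine ⟨Ring.inverse ((n + 1 : ℕ) : ℤ_[p]) *
    ∑ i ∈ Finset.range n, β i * ((n + 1).choose i : ℤ_[p]) * (q : ℤ_[p]) ^ (n - 1 - i), ?_⟩
  have h := congrArg (fun x : ℚ => (x : ℚ_[p])) (sum_range_pow q n)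
  rw [Finset.sum_range_succ] at h
  simp only [Rat.cast_add, Rat.cast_mul, Rat.cast_sum, Rat.cast_natCast, Rat.cast_pow, Rat.cast_div,
    Rat.cast_one] at h
  apply PadicInt.ext
  simp only [PadicInt.coe_sum, PadicInt.coe_mul, PadicInt.coe_add, PadicInt.coe_pow,
    PadicInt.coe_natCast, coe_ringInverse hu]
  rw [h, hb, Nat.choose_succ_self_right, Nat.add_sub_cancel_left, pow_one, mul_add, add_comm]
  congr 1
  · push_cast
    field_simp
  · rw [Finset.mul_sum, Finset.mul_sum, Finset.mul_sum]
    refine Finset.sum_congr rfl fun i hi => ?_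
    have hi : i < n := by simpa using hi
    rw [hβ i hi.le]
    have e : n + 1 - i = n - 1 - i + 2 := by omega
    rw [e, pow_add]
    push_cast
    field_simp

/-- Voronoi's congruence divided by q, which is legitimate in `ℤ_[p]`. The factor -3 is e + 1 = p -
3 mod p, and c^(p-3) ≡ c⁻² mod p. -/
theorem three_mul_pow_pred_mul_sum_mulCarry [NeZero (p ^ r)] (hr : 0 < r) (h5 : 5 ≤ p) {c : ℕ}
    (hc : IsUnit (c : ZMod (p ^ r))) {b : ℤ_[p]} (hb : (b : ℚ_[p]) = (bernoulli (p - 3) : ℚ)) :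
    -3 * ((p : ZMod (p ^ r)) ^ (r - 1) *
        ∑ a, (mulCarry p r c a : ZMod (p ^ r)) * Ring.inverse a ^ 3)
      = (p : ZMod (p ^ r)) ^ (r - 1) * (Ring.inverse (c : ZMod (p ^ r)) ^ 2 - 1)
        * PadicInt.toZModPow r b := by
  obtain ⟨e, rfl⟩ : ∃ e, p = e + 4 := ⟨p - 4, by omega⟩
  have he : 0 < e := by omega
  rw [pow_pred_mul_sum_mulCarry (e := e) (k := 1) hr he (by omega) hc]
  set p := e + 4 with hpe
  set V : ℤ := ∑ x ∈ Finset.range (p ^ r), (c * x / p ^ r : ℕ) * (x : ℤ) ^ e with hV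
  obtain ⟨w, hw⟩ := voronoi_power_sum (q := p ^ r) (Nat.pos_of_ne_zero (NeZero.ne _))
    ((ZMod.isUnit_iff_coprime _ _).1 hc) e
  rw [← hV] at hw
  have e3 : p - 3 = e + 1 := by omega
  rw [e3] at hb
  obtain ⟨z, hz⟩ := exists_sum_range_pow_eq (p := p) (n := e + 1) (by omega) hb (p ^ r)
  have hw' := congrArg (fun x : ℤ => (x : ℤ_[p])) hw
  simp only [Int.cast_sub, Int.cast_mul, Int.cast_pow, Int.cast_natCast, Int.cast_add, Int.cast_one,
    Int.cast_sum] at hw'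
  rw [hz] at hw'
  have hq0 : ((p ^ r : ℕ) : ℤ_[p]) ≠ 0 := by exact_mod_cast NeZero.ne (p ^ r)
  have key : ((e : ℤ_[p]) + 1) * c ^ e * (V : ℤ_[p]) - (c ^ (e + 1) - 1) * b
      = ((p ^ r : ℕ) : ℤ_[p]) * (w + (c ^ (e + 1) - 1) * z) := by
    apply mul_left_cancel₀ hq0
    linear_combination hw'
  have hmap := congrArg (PadicInt.toZModPow (p := p) r) key
  simp only [map_sub, map_mul, map_add, map_pow, map_natCast, map_intCast, map_one,
    ZMod.natCast_self, zero_mul] at hmap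
  have hP := pow_pred_mul_self (p := p) hr
  have hce : (p : ZMod (p ^ r)) ^ (r - 1) * Ring.inverse (c : ZMod (p ^ r)) ^ 2
      = (p : ZMod (p ^ r)) ^ (r - 1) * c ^ (e + 1) := by
    have h1 := pow_pred_mul_ringInverse_pow (k := 1) hr he (by omega) (c : ZMod (p ^ r))
    have h2 := Ring.mul_inverse_cancel _ hc
    linear_combination c * h1 - (p : ZMod (p ^ r)) ^ (r - 1) * Ring.inverse (c : ZMod (p ^ r)) ^ 2 * h2
  have hp3 : (p : ZMod (p ^ r)) = e + 4 := by rw [hpe]; push_cast; rfl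
  have hP' : (p : ZMod (p ^ r)) ^ (r - 1) * (e + 4) = 0 := by rw [← hp3]; exact hP
  linear_combination (p : ZMod (p ^ r)) ^ (r - 1) * hmap - PadicInt.toZModPow r b * hce
    - c ^ e * (V : ZMod (p ^ r)) * hP'

end HarmonicCongruence

/-! ### The addition carry for p = 3 -/

namespace HarmonicCongruence

theorem zmod_three_pow_trichotomy {r : ℕ} [NeZero (3 ^ r)] (x : ZMod (3 ^ r)) :
    3 ∣ x ∨ 3 ∣ x - 1 ∨ 3 ∣ x - -1 := by
  have hx := ZMod.natCast_zmod_val x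
  have hd : ∀ n : ℤ, 3 ∣ n → (3 : ZMod (3 ^ r)) ∣ (n : ZMod (3 ^ r)) := by
    rintro _ ⟨m, rfl⟩
    exact ⟨m, by push_cast; rfl⟩
  have h : (3 : ℤ) ∣ x.val ∨ (3 : ℤ) ∣ x.val - 1 ∨ (3 : ℤ) ∣ x.val - -1 := by omega
  rcases h with h | h | h
  · exact Or.inl (by simpa using hd _ h)
  · exact Or.inr (Or.inl (by simpa using hd _ h))
  · exact Or.inr (Or.inr (by simpa using hd _ h))

section Lift

variable {p r : ℕ} [hp : Fact p.Prime] [NeZero (p ^ r)]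

/-- The inverse in `ℤ_[p]` of the representative in `[0, p ^ r)` of a unit of `ZMod (p ^ r)`. -/
noncomputable def liftInverse (p : ℕ) [Fact p.Prime] {r : ℕ} (a : ZMod (p ^ r)) : ℤ_[p] :=
  Ring.inverse (a.val : ℤ_[p])

theorem padicInt_val_isUnit_iff (hr : 0 < r) (a : ZMod (p ^ r)) :
    IsUnit (a.val : ℤ_[p]) ↔ ¬ (p : ZMod (p ^ r)) ∣ a := by
  rw [padicInt_natCast_isUnit_iff, ← natCast_isUnit_iff hr, ZMod.natCast_zmod_val,
    zmod_isUnit_iff hr]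

theorem toZModPow_ringInverse_natCast (hr : 0 < r) (n : ℕ) :
    PadicInt.toZModPow r (Ring.inverse (n : ℤ_[p])) = Ring.inverse (n : ZMod (p ^ r)) := by
  by_cases h : p ∣ n
  · rw [Ring.inverse_non_unit, Ring.inverse_non_unit, map_zero]
    · rw [natCast_isUnit_iff hr]; simpa
    · rw [padicInt_natCast_isUnit_iff]; simpa
  · rw [map_ringInverse_of_isUnit _ ((padicInt_natCast_isUnit_iff n).2 h), map_natCast]

theorem toZModPow_liftInverse (hr : 0 < r) (a : ZMod (p ^ r)) :
    PadicInt.toZModPow r (liftInverse p a) = Ring.inverse a := by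
  rw [liftInverse, toZModPow_ringInverse_natCast hr, ZMod.natCast_zmod_val]

open scoped Classical in
theorem val_mul_liftInverse (hr : 0 < r) (a : ZMod (p ^ r)) :
    (a.val : ℤ_[p]) * liftInverse p a = if (p : ZMod (p ^ r)) ∣ a then 0 else 1 := by
  split_ifs with h
  · rw [liftInverse, Ring.inverse_non_unit, mul_zero]
    rw [padicInt_val_isUnit_iff hr]; simpa
  · exact Ring.mul_inverse_cancel _ ((padicInt_val_isUnit_iff hr a).2 h)

theorem liftInverse_of_dvd (hr : 0 < r) {a : ZMod (p ^ r)} (h : (p : ZMod (p ^ r)) ∣ a) :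
    liftInverse p a = 0 :=
  Ring.inverse_non_unit _ (by rw [padicInt_val_isUnit_iff hr]; simpa)

open scoped Classical in
-- Since q times the carry is the sum of the three representatives, multiplying by the inverses
-- cancels one factor at a time, and the three resulting sums agree by symmetry. Lifting to `ℤ_[p]`
-- keeps q from being 0, so that it can be cancelled later.
theorem pow_mul_sum_addCarry (hr : 0 < r) :
    (p : ℤ_[p]) ^ r * ∑ a : ZMod (p ^ r), ∑ b, (addCarry a b : ℤ_[p])
        * (liftInverse p a * liftInverse p b * liftInverse p (-(a + b)))
      = 3 * ∑ a : ZMod (p ^ r), ∑ b, (if (p : ZMod (p ^ r)) ∣ -(a + b) then 0 else 1)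
        * (liftInverse p a * liftInverse p b) := by
  set χ : ZMod (p ^ r) → ℤ_[p] := fun a => if (p : ZMod (p ^ r)) ∣ a then 0 else 1 with hχ
  set w : ZMod (p ^ r) → ℤ_[p] := liftInverse p with hw
  have hinv : ∀ f : ZMod (p ^ r) → ZMod (p ^ r) → ℤ_[p],
      ∑ a, ∑ b, f a (-(a + b)) = ∑ a, ∑ b, f a b := fun f =>
    Finset.sum_congr rfl fun a _ => Equiv.sum_comp (negAddEquiv a) (f a)
  have e1 : ∀ a b : ZMod (p ^ r), (p : ℤ_[p]) ^ r * (addCarry a b * (w a * w b * w (-(a + b))))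
      = χ a * (w b * w (-(a + b))) + χ b * (w a * w (-(a + b))) + χ (-(a + b)) * (w a * w b) := by
    intro a b
    have h := congrArg (fun n : ℕ => (n : ℤ_[p])) (addCarry_mul a b)
    simp only [Nat.cast_add, Nat.cast_mul, Nat.cast_pow] at h
    have ha : (a.val : ℤ_[p]) * w a = χ a := val_mul_liftInverse hr a
    have hb : (b.val : ℤ_[p]) * w b = χ b := val_mul_liftInverse hr b
    have hc : ((-(a + b)).val : ℤ_[p]) * w (-(a + b)) = χ (-(a + b)) := val_mul_liftInverse hr _
    rw [← ha, ← hb, ← hc]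
    linear_combination (-(w a * w b * w (-(a + b)))) * h
  have s2 : ∑ a, ∑ b, χ b * (w a * w (-(a + b))) = ∑ a, ∑ b, χ (-(a + b)) * (w a * w b) := by
    rw [← hinv]
    refine Finset.sum_congr rfl fun a _ => Finset.sum_congr rfl fun b _ => ?_
    rw [show -(a + -(a + b)) = b by ring]
  have s1 : ∑ a, ∑ b, χ a * (w b * w (-(a + b))) = ∑ a, ∑ b, χ (-(a + b)) * (w a * w b) := by
    rw [← s2, Finset.sum_comm]
    refine Finset.sum_congr rfl fun a _ => Finset.sum_congr rfl fun b _ => ?_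
    rw [add_comm a b]
  simp only [Finset.mul_sum]
  simp only [e1, Finset.sum_add_distrib]
  rw [s1, s2]
  simp only [← Finset.mul_sum]
  ring

theorem exists_eq_add_of_toZModPow_eq {x y : ℤ_[p]}
    (h : PadicInt.toZModPow r x = PadicInt.toZModPow r y) : ∃ z, x = y + (p : ℤ_[p]) ^ r * z := by
  have h0 : x - y ∈ RingHom.ker (PadicInt.toZModPow (p := p) r) := by
    rw [RingHom.mem_ker, map_sub, h, sub_self]
  rw [PadicInt.ker_toZModPow, Ideal.mem_span_singleton] at h0
  obtain ⟨z, hz⟩ := h0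
  exact ⟨z, by linear_combination hz⟩

end Lift

theorem sum_addCarry_three {r : ℕ} [NeZero (3 ^ r)] (hr : 0 < r) :
    ∑ a : ZMod (3 ^ r), ∑ b, (addCarry a b : ZMod (3 ^ r)) * invProd a b = 2 * 3 ^ (r - 1) := by
  classical
  have : Fact (Nat.Prime 3) := ⟨Nat.prime_three⟩
  have hodd : Odd 3 := by decide
  set w : ZMod (3 ^ r) → ℤ_[3] := liftInverse 3 with hw
  set H : ZMod (3 ^ r) → ℤ_[3] := fun s =>
    ∑ x : ZMod (3 ^ r) with ((3 : ℕ) : ZMod (3 ^ r)) ∣ x - s, w x with hH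
  have hHs : ∀ s, IsUnit s → PadicInt.toZModPow r (H s) = 3 ^ (r - 1) * Ring.inverse s := by
    intro s hs
    have := sum_ringInverse_dvd_sub (p := 3) hr hodd hs
    rw [hH, map_sum]
    simp only [hw, toZModPow_liftInverse hr]
    exact_mod_cast this
  have h2 : ¬ (3 : ZMod (3 ^ r)) ∣ 2 := by
    have := (zmod_isUnit_iff (p := 3) hr 2).1 (isUnit_two_of_odd hr hodd)
    exact_mod_cast this
  -- Modulo 3, a sum of two units is a unit exactly when they are congruent, so the double sum
  -- splits into two squares.
  have hsq : ∑ a : ZMod (3 ^ r), ∑ b, (if ((3 : ℕ) : ZMod (3 ^ r)) ∣ -(a + b) then 0 else 1)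
        * (w a * w b) = H 1 * H 1 + H (-1) * H (-1) := by
    have hterm : ∀ a b : ZMod (3 ^ r), (if (3 : ZMod (3 ^ r)) ∣ -(a + b) then 0 else 1)
        * (w a * w b) = (if (3 : ZMod (3 ^ r)) ∣ a - 1 then w a else 0)
            * (if (3 : ZMod (3 ^ r)) ∣ b - 1 then w b else 0)
          + (if (3 : ZMod (3 ^ r)) ∣ a - -1 then w a else 0)
            * (if (3 : ZMod (3 ^ r)) ∣ b - -1 then w b else 0) := by
      have hw0 : ∀ a : ZMod (3 ^ r), (3 : ZMod (3 ^ r)) ∣ a → w a = 0 := fun a ha =>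
        liftInverse_of_dvd (p := 3) hr (by exact_mod_cast ha)
      have hexcl : ∀ a : ZMod (3 ^ r), (3 : ZMod (3 ^ r)) ∣ a - 1 → ¬ (3 : ZMod (3 ^ r)) ∣ a - -1 :=
        fun a h h' => h2 (by convert dvd_sub h' h using 1; ring)
      have h1 : ¬ (3 : ZMod (3 ^ r)) ∣ 1 := fun h => h2 (h.trans (one_dvd 2))
      intro a b
      rcases zmod_three_pow_trichotomy a with ha | ha | ha
      · simp [hw0 a ha]
      · rcases zmod_three_pow_trichotomy b with hb | hb | hb
        · simp [hw0 b hb]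
        · have hab : ¬ (3 : ZMod (3 ^ r)) ∣ -(a + b) := fun h => h2 (by
            have := dvd_add h (dvd_add ha hb)
            rw [← dvd_neg]
            convert this using 1
            ring)
          rw [if_neg hab, if_pos ha, if_pos hb, if_neg (hexcl a ha)]
          ring
        · have hab : (3 : ZMod (3 ^ r)) ∣ -(a + b) := by
            rw [dvd_neg]
            convert dvd_add ha hb using 1
            ring
          rw [if_pos hab, if_neg (hexcl a ha), if_neg fun h => hexcl b h hb]
          ring
      · rcases zmod_three_pow_trichotomy b with hb | hb | hb
        · simp [hw0 b hb]
        · have hab : (3 : ZMod (3 ^ r)) ∣ -(a + b) := by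
            rw [dvd_neg]
            convert dvd_add ha hb using 1
            ring
          rw [if_pos hab, if_neg (hexcl b hb), if_neg fun h => hexcl a h ha]
          ring
        · have hab : ¬ (3 : ZMod (3 ^ r)) ∣ -(a + b) := fun h => h2 (by
            have := dvd_add h (dvd_add ha hb)
            convert this using 1
            ring)
          rw [if_neg hab, if_pos ha, if_pos hb, if_neg fun h => hexcl a h ha]
          ring
    simp only [hH, Finset.sum_filter, Finset.sum_mul_sum, ← Finset.sum_add_distrib]
    refine Finset.sum_congr rfl fun a _ => Finset.sum_congr rfl fun b _ => ?_
    exact_mod_cast hterm a b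
  have hE := pow_mul_sum_addCarry (p := 3) hr
  rw [hsq] at hE
  set E : ℤ_[3] := ∑ a : ZMod (3 ^ r), ∑ b, (addCarry a b : ℤ_[3])
    * (w a * w b * w (-(a + b))) with hEdef
  have hmapE : PadicInt.toZModPow r E
      = ∑ a : ZMod (3 ^ r), ∑ b, (addCarry a b : ZMod (3 ^ r)) * invProd a b := by
    simp only [hEdef, map_sum, map_mul, map_natCast, hw, toZModPow_liftInverse hr, invProd]
  have i1 : Ring.inverse (1 : ZMod (3 ^ r)) = 1 := Ring.inverse_one _
  obtain ⟨x, hx⟩ := exists_eq_add_of_toZModPow_eq (p := 3) (r := r) (x := H 1)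
    (y := 3 ^ (r - 1)) (by rw [hHs 1 isUnit_one, i1, map_pow, map_ofNat, mul_one])
  obtain ⟨y, hy⟩ := exists_eq_add_of_toZModPow_eq (p := 3) (r := r) (x := H (-1))
    (y := -3 ^ (r - 1)) (by
      rw [hHs _ isUnit_one.neg, ringInverse_neg, i1, map_neg, map_pow, map_ofNat, mul_neg, mul_one])
  rw [hx, hy] at hE
  rw [← hmapE]
  obtain ⟨s, rfl⟩ : ∃ s, r = s + 1 := ⟨r - 1, by omega⟩
  rw [Nat.add_sub_cancel] at *
  have h0 : (3 : ℤ_[3]) ^ (s + 1) ≠ 0 := pow_ne_zero _ (by norm_num)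
  -- Knowing H(±1) modulo 3^r suffices: both are divisible by 3^(r-1), so 3(H(1)² + H(-1)²) is
  -- determined modulo 3^(2r), and E modulo 3^r.
  have hE' : E = 3 ^ s * 2 + 3 ^ (s + 1) * (2 * x - 2 * y + 3 * x ^ 2 + 3 * y ^ 2) := by
    apply mul_left_cancel₀ h0
    push_cast at hE
    linear_combination hE
  have hq : (3 : ZMod (3 ^ (s + 1))) ^ (s + 1) = 0 := by
    exact_mod_cast ZMod.natCast_self (3 ^ (s + 1))
  rw [hE', map_add, map_mul, map_mul, map_pow, map_pow, map_ofNat, map_ofNat, hq]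
  ring

end HarmonicCongruence

/-! ### Assembling the congruence and returning to ℚ -/

namespace HarmonicCongruence

variable {p r : ℕ} [hp : Fact p.Prime]

theorem pIntegral_of_coe_eq {x : ℚ} {X : ℤ_[p]} (hX : (X : ℚ_[p]) = (x : ℚ_[p])) :
    PIntegral p x :=
  (padicInt_natCast_isUnit_iff x.den).1 (PadicInt.isUnit_den x (hX ▸ X.norm_le_one))

theorem ratModEq_of_toZModPow_eq {x y : ℚ} {X Y : ℤ_[p]} (hX : (X : ℚ_[p]) = (x : ℚ_[p]))
    (hY : (Y : ℚ_[p]) = (y : ℚ_[p])) (h : PadicInt.toZModPow r X = PadicInt.toZModPow r Y) :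
    RatModEq p r x y := by
  have : NeZero (p ^ r) := ⟨pow_ne_zero _ hp.out.ne_zero⟩
  refine ⟨pIntegral_of_coe_eq hX, pIntegral_of_coe_eq hY, (x - y) / (p : ℚ) ^ r, ?_, ?_⟩
  · obtain ⟨Z, hZ⟩ := exists_eq_add_of_toZModPow_eq h
    apply pIntegral_of_coe_eq (X := Z)
    have h0 : (p : ℚ_[p]) ^ r ≠ 0 := pow_ne_zero _ (by exact_mod_cast hp.out.ne_zero)
    push_cast
    rw [← hX, ← hY, hZ, eq_div_iff h0]
    push_cast
    ring
  · have h0 : (p : ℚ) ^ r ≠ 0 := pow_ne_zero _ (by exact_mod_cast hp.out.ne_zero)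
    field_simp

theorem coe_ringInverse_natCast {n : ℕ} (hn : ¬ p ∣ n) :
    ((Ring.inverse (n : ℤ_[p]) : ℤ_[p]) : ℚ_[p]) = (n : ℚ_[p])⁻¹ := by
  rw [coe_ringInverse ((padicInt_natCast_isUnit_iff n).2 hn), PadicInt.coe_natCast]

theorem coe_sum_solutions {c₁ c₂ c₃ N : ℕ} :
    ((∑ s ∈ solutions c₁ c₂ c₃ p N, Ring.inverse (s.1 : ℤ_[p]) * Ring.inverse (s.2.1 : ℤ_[p])
        * Ring.inverse (s.2.2 : ℤ_[p]) : ℤ_[p]) : ℚ_[p])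
      = ((∑ t ∈ solutions c₁ c₂ c₃ p N, 1 / ((t.1 : ℚ) * (t.2.1 : ℚ) * (t.2.2 : ℚ)) : ℚ) : ℚ_[p]) := by
  rw [PadicInt.coe_sum, Rat.cast_sum]
  refine Finset.sum_congr rfl fun s hs => ?_
  have hco := (Finset.mem_filter.1 hs).2.1
  rw [Nat.coprime_comm, hp.out.coprime_iff_not_dvd, hp.out.dvd_mul, hp.out.dvd_mul] at hco
  rw [PadicInt.coe_mul, PadicInt.coe_mul, coe_ringInverse_natCast (by tauto),
    coe_ringInverse_natCast (by tauto), coe_ringInverse_natCast (by tauto)]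
  push_cast
  rw [one_div, mul_inv, mul_inv]

theorem toZModPow_sum_solutions (hr : 0 < r) {c₁ c₂ c₃ N : ℕ} :
    PadicInt.toZModPow r (∑ s ∈ solutions c₁ c₂ c₃ p N, Ring.inverse (s.1 : ℤ_[p])
        * Ring.inverse (s.2.1 : ℤ_[p]) * Ring.inverse (s.2.2 : ℤ_[p]))
      = ∑ s ∈ solutions c₁ c₂ c₃ p N, Ring.inverse (s.1 : ZMod (p ^ r))
        * Ring.inverse (s.2.1 : ZMod (p ^ r)) * Ring.inverse (s.2.2 : ZMod (p ^ r)) := by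
  simp only [map_sum, map_mul, toZModPow_ringInverse_natCast hr]

theorem exists_sq_eq_one_add_three_mul {c : ℕ} (hc : ¬ 3 ∣ c) : ∃ d : ℤ, (c : ℤ) ^ 2 = 1 + 3 * d := by
  obtain ⟨k, hk⟩ : ∃ k, c = 3 * k + 1 ∨ c = 3 * k + 2 := ⟨c / 3, by omega⟩
  rcases hk with rfl | rfl
  · exact ⟨3 * k ^ 2 + 2 * k, by push_cast; ring⟩
  · exact ⟨3 * k ^ 2 + 4 * k + 1, by push_cast; ring⟩

variable [NeZero (p ^ r)]

theorem sum_solutions_congr_of_five_le (hr : 0 < r) (h5 : 5 ≤ p) {c₁ c₂ c₃ : ℕ} (h₁ : 0 < c₁)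
    (h₂ : 0 < c₂) (h₃ : 0 < c₃) (h₁₂ : Nat.Coprime c₁ c₂) (h₁₃ : Nat.Coprime c₁ c₃)
    (h₂₃ : Nat.Coprime c₂ c₃) (u₁ : IsUnit (c₁ : ZMod (p ^ r))) (u₂ : IsUnit (c₂ : ZMod (p ^ r)))
    (u₃ : IsUnit (c₃ : ZMod (p ^ r))) (t : ℕ) {b : ℤ_[p]}
    (hb : (b : ℚ_[p]) = (bernoulli (p - 3) : ℚ)) :
    ∑ s ∈ solutions c₁ c₂ c₃ p (t * (c₁ * c₂ * c₃) * p ^ r), Ring.inverse (s.1 : ZMod (p ^ r))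
        * Ring.inverse (s.2.1 : ZMod (p ^ r)) * Ring.inverse (s.2.2 : ZMod (p ^ r))
      = -2 * p ^ (r - 1) * PadicInt.toZModPow r b
        * ((t * (c₁ * c₂ * c₃) : ℕ) * Ring.inverse ((3 : ℕ) : ZMod (p ^ r)))
        * (Ring.inverse (c₁ : ZMod (p ^ r)) ^ 2 + Ring.inverse (c₂ : ZMod (p ^ r)) ^ 2
          + Ring.inverse (c₃ : ZMod (p ^ r)) ^ 2) := by
  have hodd : Odd p := hp.out.odd_of_ne_two (by omega)
  have w2 := isUnit_two_of_odd (p := p) hr hodd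
  have w3 : IsUnit ((3 : ℕ) : ZMod (p ^ r)) :=
    (natCast_isUnit_iff hr 3).2 (Nat.not_dvd_of_pos_of_lt (by norm_num) (by omega))
  rw [sum_solutions_eq_carries hr hodd h₁ h₂ h₃ h₁₂ h₁₃ h₂₃ u₁ u₂ u₃]
  have hE := six_mul_sum_addCarry (p := p) hr hodd
  have k1 := three_mul_pow_pred_mul_sum_mulCarry hr h5 u₁ hb
  have k2 := three_mul_pow_pred_mul_sum_mulCarry hr h5 u₂ hb
  have k3 := three_mul_pow_pred_mul_sum_mulCarry hr h5 u₃ hb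
  have k0 := three_mul_pow_pred_mul_sum_mulCarry (c := 2) hr h5 (by exact_mod_cast w2) hb
  have i2 := Ring.mul_inverse_cancel _ w2
  have i3 := Ring.mul_inverse_cancel _ w3
  set E := ∑ a : ZMod (p ^ r), ∑ b, (addCarry a b : ZMod (p ^ r)) * invProd a b
  set M₁ := ∑ a, (mulCarry p r c₁ a : ZMod (p ^ r)) * Ring.inverse a ^ 3
  set M₂ := ∑ a, (mulCarry p r c₂ a : ZMod (p ^ r)) * Ring.inverse a ^ 3
  set M₃ := ∑ a, (mulCarry p r c₃ a : ZMod (p ^ r)) * Ring.inverse a ^ 3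
  set M₀ := ∑ a, (mulCarry p r 2 a : ZMod (p ^ r)) * Ring.inverse a ^ 3
  set P := (p : ZMod (p ^ r)) ^ (r - 1)
  set β := PadicInt.toZModPow r b
  push_cast at i3 k0 w3 ⊢
  have hE' : E = 2 * P * β := by
    have h12 : IsUnit (2 * 3 : ZMod (p ^ r)) := w2.mul w3
    apply h12.mul_left_cancel
    have i4 : (2 * Ring.inverse (2 : ZMod (p ^ r))) ^ 2 = 1 := by rw [i2, one_pow]
    -- The case c = 2 has c⁻² - 1 = -3/4, so 48p^(r-1) M₀ = 12p^(r-1) β.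
    have h16 : 3 * (16 * (P * M₀)) = 12 * (P * β) := by
      linear_combination (-16) * k0 - 4 * P * β * i4
    have : (3 : ZMod (p ^ r)) * (2 * 3 * E) = 3 * (2 * 3 * (2 * P * β)) := by
      linear_combination 3 * hE + 3 * h16
    exact w3.mul_left_cancel this
  apply w3.mul_left_cancel
  rw [hE']
  linear_combination (-(2 : ZMod (p ^ r)) * t * (c₁ * c₂ * c₃)) * (k1 + k2 + k3)
    + 2 * P * β * t * (c₁ * c₂ * c₃) * (Ring.inverse (c₁ : ZMod (p ^ r)) ^ 2
      + Ring.inverse (c₂ : ZMod (p ^ r)) ^ 2 + Ring.inverse (c₃ : ZMod (p ^ r)) ^ 2) * i3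

/-- As dᵢ/cᵢ² = (1 - cᵢ⁻²)/3, the last factor is an integral form of (c₁⁻² + c₂⁻² + c₃⁻²)/3. -/
theorem sum_solutions_congr_three {r : ℕ} [NeZero (3 ^ r)] (hr : 0 < r) {c₁ c₂ c₃ : ℕ} (h₁ : 0 < c₁)
    (h₂ : 0 < c₂) (h₃ : 0 < c₃) (h₁₂ : Nat.Coprime c₁ c₂) (h₁₃ : Nat.Coprime c₁ c₃)
    (h₂₃ : Nat.Coprime c₂ c₃) (u₁ : IsUnit (c₁ : ZMod (3 ^ r))) (u₂ : IsUnit (c₂ : ZMod (3 ^ r)))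
    (u₃ : IsUnit (c₃ : ZMod (3 ^ r))) (t : ℕ) {d₁ d₂ d₃ : ℤ} (hd₁ : (c₁ : ℤ) ^ 2 = 1 + 3 * d₁)
    (hd₂ : (c₂ : ℤ) ^ 2 = 1 + 3 * d₂) (hd₃ : (c₃ : ℤ) ^ 2 = 1 + 3 * d₃) :
    ∑ s ∈ solutions c₁ c₂ c₃ 3 (t * (c₁ * c₂ * c₃) * 3 ^ r), Ring.inverse (s.1 : ZMod (3 ^ r))
        * Ring.inverse (s.2.1 : ZMod (3 ^ r)) * Ring.inverse (s.2.2 : ZMod (3 ^ r))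
      = -2 * 3 ^ (r - 1) * (t * (c₁ * c₂ * c₃) : ℕ)
        * (1 - d₁ * Ring.inverse (c₁ : ZMod (3 ^ r)) ^ 2 - d₂ * Ring.inverse (c₂ : ZMod (3 ^ r)) ^ 2
          - d₃ * Ring.inverse (c₃ : ZMod (3 ^ r)) ^ 2) := by
  have : Fact (Nat.Prime 3) := ⟨Nat.prime_three⟩
  rw [sum_solutions_eq_carries (p := 3) hr (by decide) h₁ h₂ h₃ h₁₂ h₁₃ h₂₃ u₁ u₂ u₃,
    sum_addCarry_three hr]
  have k1 := pow_pred_mul_sum_mulCarry_three hr u₁ hd₁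
  have k2 := pow_pred_mul_sum_mulCarry_three hr u₂ hd₂
  have k3 := pow_pred_mul_sum_mulCarry_three hr u₃ hd₃
  have sq : ∀ {x : ZMod (3 ^ r)}, IsUnit x →
      (3 : ZMod (3 ^ r)) ^ (r - 1) * Ring.inverse x ^ 2 = 3 ^ (r - 1) := fun hx => by
    exact_mod_cast pow_pred_mul_pow_sub_one (p := 3) hr hx.ringInverse
  have s1 := sq u₁
  have s2 := sq u₂
  have s3 := sq u₃
  push_cast
  linear_combination (2 * t * (c₁ * c₂ * c₃) : ZMod (3 ^ r)) * (k1 + k2 + k3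
    - d₁ * s1 - d₂ * s2 - d₃ * s3)

end HarmonicCongruence

theorem theorem3 (c₁ c₂ c₃ C : ℕ) (h₁ : 0 < c₁) (h₂ : 0 < c₂) (h₃ : 0 < c₃) (hC : 0 < C)
    (h₁₂ : Nat.Coprime c₁ c₂) (h₁₃ : Nat.Coprime c₁ c₃) (h₂₃ : Nat.Coprime c₂ c₃)
    (hC₁ : c₁ ∣ C) (hC₂ : c₂ ∣ C) (hC₃ : c₃ ∣ C)
    (p : ℕ) (hp : Nat.Prime p) (hpodd : Odd p)
    (hp₁ : ¬ p ∣ c₁) (hp₂ : ¬ p ∣ c₂) (hp₃ : ¬ p ∣ c₃) (r : ℕ) (hr : 0 < r) :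
    HarmonicCongruence.RatModEq p r
      (∑ t ∈ HarmonicCongruence.solutions c₁ c₂ c₃ p (C * p ^ r),
        1 / ((t.1 : ℚ) * (t.2.1 : ℚ) * (t.2.2 : ℚ)))
      (-2 * (p : ℚ) ^ (r - 1) * bernoulli (p - 3) * ((C : ℚ) / 3) *
        (1 / (c₁ : ℚ) ^ 2 + 1 / (c₂ : ℚ) ^ 2 + 1 / (c₃ : ℚ) ^ 2)) := by
  open HarmonicCongruence in
  have : Fact p.Prime := ⟨hp⟩
  have : NeZero (p ^ r) := ⟨pow_ne_zero _ hp.ne_zero⟩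
  have u₁ := (natCast_isUnit_iff hr c₁).2 hp₁
  have u₂ := (natCast_isUnit_iff hr c₂).2 hp₂
  have u₃ := (natCast_isUnit_iff hr c₃).2 hp₃
  obtain ⟨t, ht⟩ : c₁ * c₂ * c₃ ∣ C :=
    (Nat.Coprime.mul_left h₁₃ h₂₃).mul_dvd_of_dvd_of_dvd (h₁₂.mul_dvd_of_dvd_of_dvd hC₁ hC₂) hC₃
  rw [mul_comm] at ht
  subst ht
  by_cases h5 : 5 ≤ p
  · obtain ⟨b, hb⟩ := exists_padicInt_bernoulli (p := p) (i := p - 3) (by omega)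
    have hp3 : ¬ p ∣ 3 := Nat.not_dvd_of_pos_of_lt (by norm_num) (by omega)
    refine ratModEq_of_toZModPow_eq coe_sum_solutions
      (Y := -2 * p ^ (r - 1) * b * ((t * (c₁ * c₂ * c₃) : ℕ) * Ring.inverse ((3 : ℕ) : ℤ_[p]))
        * (Ring.inverse (c₁ : ℤ_[p]) ^ 2 + Ring.inverse (c₂ : ℤ_[p]) ^ 2
          + Ring.inverse (c₃ : ℤ_[p]) ^ 2)) ?_ ?_
    · simp only [PadicInt.coe_mul, PadicInt.coe_add, PadicInt.coe_pow, PadicInt.coe_neg,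
        PadicInt.coe_natCast, coe_ringInverse_natCast hp3, coe_ringInverse_natCast hp₁,
        coe_ringInverse_natCast hp₂, coe_ringInverse_natCast hp₃, hb]
      have e2 : ((2 : ℤ_[p]) : ℚ_[p]) = 2 := PadicInt.coe_natCast 2
      rw [e2]
      push_cast
      simp only [inv_pow, div_eq_mul_inv, one_mul]
    · rw [toZModPow_sum_solutions hr,
        sum_solutions_congr_of_five_le hr h5 h₁ h₂ h₃ h₁₂ h₁₃ h₂₃ u₁ u₂ u₃ t hb]
      simp only [map_mul, map_add, map_neg, map_pow, map_natCast, map_ofNat,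
        toZModPow_ringInverse_natCast hr]
  · have hp3 : p = 3 := by
      have := hp.two_le
      obtain ⟨k, hk⟩ := hpodd
      omega
    subst hp3
    obtain ⟨d₁, hd₁⟩ := exists_sq_eq_one_add_three_mul hp₁
    obtain ⟨d₂, hd₂⟩ := exists_sq_eq_one_add_three_mul hp₂
    obtain ⟨d₃, hd₃⟩ := exists_sq_eq_one_add_three_mul hp₃
    -- Here B_{p-3} = B₀ = 1. The 1/3 has no meaning in `ℤ_[3]`, so the witness uses the dᵢ instead.
    refine ratModEq_of_toZModPow_eq coe_sum_solutions
      (Y := -2 * 3 ^ (r - 1) * (t * (c₁ * c₂ * c₃) : ℕ) * (1 - d₁ * Ring.inverse (c₁ : ℤ_[3]) ^ 2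
        - d₂ * Ring.inverse (c₂ : ℤ_[3]) ^ 2 - d₃ * Ring.inverse (c₃ : ℤ_[3]) ^ 2)) ?_ ?_
    · have hinv : ∀ {c : ℕ} {d : ℤ}, 0 < c → (c : ℤ) ^ 2 = 1 + 3 * d →
          (d : ℚ_[3]) * ((c : ℚ_[3])⁻¹) ^ 2 = (1 - ((c : ℚ_[3])⁻¹) ^ 2) / 3 := by
        intro c d hc hd
        have hc0 : (c : ℚ_[3]) ≠ 0 := by exact_mod_cast hc.ne'
        have hd' : (c : ℚ_[3]) ^ 2 = 1 + 3 * d := by exact_mod_cast congrArg (Int.cast : ℤ → ℚ_[3]) hd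
        field_simp
        linear_combination -hd'
      simp only [PadicInt.coe_mul, PadicInt.coe_sub, PadicInt.coe_pow, PadicInt.coe_neg,
        PadicInt.coe_natCast, PadicInt.coe_intCast, PadicInt.coe_one,
        coe_ringInverse_natCast hp₁, coe_ringInverse_natCast hp₂, coe_ringInverse_natCast hp₃]
      have e2 : ((2 : ℤ_[3]) : ℚ_[3]) = 2 := PadicInt.coe_natCast 2
      have e3 : ((3 : ℤ_[3]) : ℚ_[3]) = 3 := PadicInt.coe_natCast 3
      rw [e2, e3, hinv h₁ hd₁, hinv h₂ hd₂, hinv h₃ hd₃]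
      rw [Nat.sub_self, bernoulli_zero]
      push_cast
      simp only [one_div, inv_pow]
      ring
    · rw [toZModPow_sum_solutions hr,
        sum_solutions_congr_three hr h₁ h₂ h₃ h₁₂ h₁₃ h₂₃ u₁ u₂ u₃ t hd₁ hd₂ hd₃]
      simp only [map_mul, map_sub, map_neg, map_pow, map_natCast, map_intCast, map_ofNat, map_one,
        toZModPow_ringInverse_natCast hr]
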